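/- Let $n\ge 3$ and $1\le k\le n$ be integers with $n<2k$, let $\theta,\rho\in\mathbb R$, and put $m=\frac{n-2k}{n+2k}<0$. For a positive function $u$ on $\mathbb R^n$ let $g_u=u^{\frac{4k}{n+2k}}|dx|^2$, let $A_g=\frac1{n-2}\big(\mathrm{Ric}_g-\frac{R_g}{2(n-1)}g\big)$ denote the Schouten tensor of a metric $g$, and let $\sigma_j(g)$ be the $j$-th elementary symmetric function of the eigenvalues of $g^{-1}A_g$. Call $u$ admissible if $\sigma_1(g_u),\dots,\sigma_k(g_u)>0$ on $\mathbb R^n$. Consider on $\mathbb R^n$ the equation $$\sigma_k^{1/k}\Big(D^2\big(u^{-\frac{2k}{n+2k}}\big)-\frac{u^{\frac{2k}{n+2k}}}{2}\big|D\big(u^{-\frac{2k}{n+2k}}\big)\big|^2 I\Big)=u^{\frac{2k}{n+2k}-1}\Big[(2\theta+\rho)u+\frac{4k\theta}{n+2k}\,x\cdot Du\Big],\qquad(\ast)$$ where on the left $\sigma_k$ of a symmetric matrix is the $k$-th elementary symmetric function of its eigenvalues, and all derivatives and norms are Euclidean. (i) If $\rho<2\theta$, then $(\ast)$ has no positive,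 radially symmetric, admissible solution of class $C^2$ on $\mathbb R^n$. There is also no such solution when $\rho\le 0$ (the steady and expanding cases). (ii) If $\theta\ge 0$, $2\theta+\rho>0$ and $\rho\ge 2\theta$, then for every $\alpha>0$ there is a positive, smooth, radially symmetric, admissible solution $u_\alpha$ of $(\ast)$ on $\mathbb R^n$ with $u_\alpha(0)=\alpha$, and $u_\alpha(x)=O\big(|x|^{-\frac{4}{1-m}}\big)$ as $|x|\to\infty$. -/

import Mathlib

namespace KYamabe

noncomputable section

/-- `ℝⁿ` with its Euclidean norm. -/
abbrev E (n : ℕ) := EuclideanSpace ℝ (Fin n)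

/-- The partial derivative `∂ᵢ f (x)`. -/
def pd {n : ℕ} (i : Fin n) (f : E n → ℝ) (x : E n) : ℝ :=
  fderiv ℝ f x (EuclideanSpace.single i 1)

/-- The Euclidean Hessian matrix `D² f (x)`. -/
def hess {n : ℕ} (f : E n → ℝ) (x : E n) : Matrix (Fin n) (Fin n) ℝ :=
  Matrix.of fun i j => pd i (pd j f) x

/-- `σ_k(A)`: the `k`-th elementary symmetric function of the eigenvalues of `A` (the roots of the
characteristic polynomial, with multiplicity), for a real diagonalizable matrix `A`.
It is used only for symmetric matrices. -/
def sigma {n : ℕ} (k : ℕ) (A : Matrix (Fin n) (Fin n) ℝ) : ℝ :=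
  A.charpoly.roots.esymm k

section Curvature

/-! Curvature of a Riemannian metric on `ℝⁿ`, given in the global chart by its matrix field
`g = (g_{ij})`. -/

variable {n : ℕ}

/-- The Christoffel symbol
`Γ^l_{ij} = ½ g^{lm} (∂ᵢ g_{mj} + ∂ⱼ g_{mi} - ∂ₘ g_{ij})`. -/
def christoffel (g : E n → Matrix (Fin n) (Fin n) ℝ) (l i j : Fin n) (x : E n) : ℝ :=
  (1 / 2) * ∑ m, (g x)⁻¹ l m *
    (pd i (fun y => g y m j) x + pd j (fun y => g y m i) x - pd m (fun y => g y i j) x)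

/-- The Ricci tensor
`R_{ij} = ∂ₗ Γ^l_{ij} - ∂ⱼ Γ^l_{il} + Γ^l_{lm} Γ^m_{ij} - Γ^l_{jm} Γ^m_{il}`. -/
def ricci (g : E n → Matrix (Fin n) (Fin n) ℝ) (x : E n) : Matrix (Fin n) (Fin n) ℝ :=
  Matrix.of fun i j =>
    ∑ l, (pd l (christoffel g l i j) x - pd j (christoffel g l i l) x) +
    ∑ l, ∑ m, (christoffel g l l m x * christoffel g m i j x
      - christoffel g l j m x * christoffel g m i l x)

/-- The scalar curvature `R = g^{ij} R_{ij}`. -/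
def scalarCurvature (g : E n → Matrix (Fin n) (Fin n) ℝ) (x : E n) : ℝ :=
  ∑ i, ∑ j, (g x)⁻¹ i j * ricci g x i j

/-- The Schouten tensor `A_g = (1/(n-2)) (Ric - R/(2(n-1)) g)`, for `n ≥ 3`. -/
def schouten (g : E n → Matrix (Fin n) (Fin n) ℝ) (x : E n) : Matrix (Fin n) (Fin n) ℝ :=
  (1 / ((n : ℝ) - 2)) •
    (ricci g x - (scalarCurvature g x / (2 * ((n : ℝ) - 1))) • g x)

/-- `σ_j(g) = σ_j(g⁻¹ A_g)` at the point `x`. -/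
def sigmaMetric (j : ℕ) (g : E n → Matrix (Fin n) (Fin n) ℝ) (x : E n) : ℝ :=
  sigma j ((g x)⁻¹ * schouten g x)

end Curvature

/-- The conformally flat metric `g_u = u^{4k/(n+2k)} |dx|²`. -/
def conformalMetric {n : ℕ} (k : ℕ) (u : E n → ℝ) (x : E n) : Matrix (Fin n) (Fin n) ℝ :=
  (u x ^ (4 * (k : ℝ) / ((n : ℝ) + 2 * k))) • (1 : Matrix (Fin n) (Fin n) ℝ)

/-- `u` is admissible: `g_u` lies in the positive cone `Γ_k⁺`, that is
`σ_1(g_u), …, σ_k(g_u) > 0` everywhere. -/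
def Admissible {n : ℕ} (k : ℕ) (u : E n → ℝ) : Prop :=
  ∀ j : ℕ, 1 ≤ j → j ≤ k → ∀ x, 0 < sigmaMetric j (conformalMetric k u) x

/-- The function `v = u^{-2k/(n+2k)}`, for which `g_u = v⁻² |dx|²`. -/
def vOf {n : ℕ} (k : ℕ) (u : E n → ℝ) (x : E n) : ℝ :=
  u x ^ (-(2 * (k : ℝ) / ((n : ℝ) + 2 * k)))

/-- The elliptic equation at the point `x`: with `v = u^{-2k/(n+2k)}`,
`σ_k^{1/k}(D²v - (u^{2k/(n+2k)}/2) |Dv|² I)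
  = u^{2k/(n+2k) - 1} [(2θ + ρ) u + (4kθ/(n+2k)) x · Du]`. -/
def EllipticEq {n : ℕ} (k : ℕ) (θ ρ : ℝ) (u : E n → ℝ) (x : E n) : Prop :=
  sigma k (hess (vOf k u) x
      - (u x ^ (2 * (k : ℝ) / ((n : ℝ) + 2 * k)) / 2 * ‖gradient (vOf k u) x‖ ^ 2) •
        (1 : Matrix (Fin n) (Fin n) ℝ)) ^ (1 / (k : ℝ))
    = u x ^ (2 * (k : ℝ) / ((n : ℝ) + 2 * k) - 1) *
      ((2 * θ + ρ) * u x + 4 * (k : ℝ) * θ / ((n : ℝ) + 2 * k) * inner ℝ x (gradient u x))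

/-- `u` is radially symmetric about the origin. -/
def IsRadial {n : ℕ} (u : E n → ℝ) : Prop :=
  ∀ x y : E n, ‖x‖ = ‖y‖ → u x = u y

/-- `u` is a positive classical solution of the elliptic equation on all of `ℝⁿ` that is
admissible and radial. -/
structure IsAdmissibleRadialSolution {n : ℕ} (k : ℕ) (θ ρ : ℝ) (u : E n → ℝ) : Prop where
  contDiff : ContDiff ℝ 2 u
  pos : ∀ x, 0 < u x
  radial : IsRadial u
  equation : ∀ x, EllipticEq k θ ρ u x
  admissible : Admissible k u

end

end KYamabe

/-! ## Elementary symmetric functions of rank one perturbations of the identity -/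

namespace KYamabe

open Polynomial

/-! Put v = u^{-2k/(n+2k)} = exp(S(τ)) with τ = |x|², and p = 2τS'(τ) = d log v / d log r. The
matrix D²v − |Dv|²/(2v) I is e^S times a matrix with eigenvalue b = 2S'(1 − τS') on the n−1
tangential directions and a = b + 4τ(S'² + S'') on the radial one; note τb = p(2−p)/2. With F(p) =
2θ + ρ − 2θp, the equation becomes (e^{kS} σ_k(a,b,…,b))^{1/k} = e^{-S} F(p). This reduction is
`sigmaMetric_eq_radialSigma` and `ellipticEq_iff`.

Nonexistence: n < 2k and n ≥ 3 force k ≥ 2, so the cone condition gives b > 0, that is 0 < p < 2.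
Then σ_k > 0 gives (n−k)b + ka > 0, which in t = log τ reads p' > (2k−n)/(4k) · p(2−p). Since 2k − n
> 0, p comes arbitrarily close to both 0 and 2. The left side of the equation is positive, so F(p) >
0 along the whole trajectory, and this is only possible if ρ ≥ 2θ and ρ > 0 (`exists_profile`,
`two_theta_le_and_pos`).

Existence: introduce η by a = b(1 − nη/k). Then σ_i = C(n,i) b^i (1 − iη/k), so b > 0 and 0 ≤ η < 1
imply admissibility, and the equation is the scalar relation C(n,k) b^k (1−η) e^{2kS} = F(p)^k. Its
logarithmic derivative in log r, together with the definition of η, is an autonomous planar system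
for (p, η) involving g(p) = θ(2−p)/F(p). Conversely the relation is a first integral of that system,
so it suffices to solve the system and match the value at the origin (`exists_log_profile`). The
hypotheses on θ, ρ make g smooth and nonnegative on [0,2], which confines trajectories to [0,2] ×
[0,1] and makes them global (`exists_global_profile`). Smoothness at the origin comes from a
singular initial value problem in τ, solved by weighted averages (`exists_contDiffOn_singular_ode`).
The decay follows by bounding S − log τ below by means of log p (`exists_log_profile_lower_bound`).
-/

theorem esymm_cons_succ (a : ℝ) (s : Multiset ℝ) (j : ℕ) :
    (a ::ₘ s).esymm (j + 1) = s.esymm (j + 1) + a * s.esymm j := by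
  simp [Multiset.esymm, Multiset.powersetCard_cons, Multiset.map_map,
    Multiset.sum_map_mul_left]

theorem esymm_replicate (a : ℝ) (N j : ℕ) :
    (Multiset.replicate N a).esymm j = (N.choose j : ℝ) * a ^ j := by
  induction N generalizing j with
  | zero =>
    cases j with
    | zero => simp [Multiset.esymm]
    | succ j => simp [Multiset.esymm, Multiset.powersetCard_zero_right]
  | succ N ih =>
    cases j with
    | zero => simp [Multiset.esymm]
    | succ j =>
      rw [Multiset.replicate_succ, esymm_cons_succ, ih, ih, Nat.choose_succ_succ]
      push_cast
      ring

/-- A radial Hessian is a multiple of the identity plus a multiple of x xᵀ. The characteristic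
polynomial of the rank one part is known, and the scalar part only translates the variable. -/
theorem charpoly_smul_one_add_vecMulVec {n : ℕ} (hn : 1 ≤ n) (lam mu : ℝ) (x : Fin n → ℝ) :
    (lam • (1 : Matrix (Fin n) (Fin n) ℝ) + mu • Matrix.vecMulVec x x).charpoly
      = (X - C (lam + mu * (x ⬝ᵥ x))) * (X - C lam) ^ (n - 1) := by
  have h : lam • (1 : Matrix (Fin n) (Fin n) ℝ) + mu • Matrix.vecMulVec x x
      = Matrix.vecMulVec (mu • x) x - Matrix.scalar (Fin n) (-lam) := by
    rw [Matrix.smul_vecMulVec]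
    ext i j
    simp [Matrix.one_apply, Matrix.diagonal_apply]
    split_ifs <;> ring
  rw [h, Matrix.charpoly_sub_scalar, Matrix.charpoly_vecMulVec]
  obtain ⟨N, rfl⟩ : ∃ N, n = N + 1 := ⟨n - 1, by omega⟩
  simp [pow_succ, Polynomial.smul_eq_C_mul]
  ring

/-- Elementary symmetric functions of a rank one perturbation of a multiple of the identity. -/
theorem sigma_smul_one_add_vecMulVec {n : ℕ} (hn : 1 ≤ n) (lam mu : ℝ) (x : Fin n → ℝ) (j : ℕ) :
    sigma (j + 1) (lam • (1 : Matrix (Fin n) (Fin n) ℝ) + mu • Matrix.vecMulVec x x)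
      = ((n - 1).choose (j + 1) : ℝ) * lam ^ (j + 1)
        + (lam + mu * (x ⬝ᵥ x)) * (((n - 1).choose j : ℝ) * lam ^ j) := by
  rw [sigma, charpoly_smul_one_add_vecMulVec hn, Polynomial.roots_mul, Polynomial.roots_X_sub_C,
    Polynomial.roots_pow, Polynomial.roots_X_sub_C, Multiset.nsmul_singleton,
    Multiset.singleton_add, esymm_cons_succ, esymm_replicate, esymm_replicate]
  exact mul_ne_zero (X_sub_C_ne_zero _) (pow_ne_zero _ (X_sub_C_ne_zero _))

end KYamabe

/-! ## Curvature of conformally flat metrics -/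

namespace KYamabe

section Calculus

variable {n : ℕ} {f h : E n → ℝ} {x : E n}

theorem pd_const_mul (c : ℝ) (hf : DifferentiableAt ℝ f x) (i : Fin n) :
    pd i (fun y => c * f y) x = c * pd i f x := by
  simp [pd, fderiv_const_mul hf]

theorem pd_add (hf : DifferentiableAt ℝ f x) (hh : DifferentiableAt ℝ h x) (i : Fin n) :
    pd i (fun y => f y + h y) x = pd i f x + pd i h x := by
  simp [pd, fderiv_fun_add hf hh]

theorem pd_sub (hf : DifferentiableAt ℝ f x) (hh : DifferentiableAt ℝ h x) (i : Fin n) :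
    pd i (fun y => f y - h y) x = pd i f x - pd i h x := by
  simp [pd, fderiv_fun_sub hf hh]

theorem pd_mul (hf : DifferentiableAt ℝ f x) (hh : DifferentiableAt ℝ h x) (i : Fin n) :
    pd i (fun y => f y * h y) x = f x * pd i h x + h x * pd i f x := by
  simp [pd, fderiv_fun_mul hf hh]

theorem pd_comp {φ : ℝ → ℝ} {φ' : ℝ} (hφ : HasDerivAt φ φ' (f x)) (hf : DifferentiableAt ℝ f x)
    (i : Fin n) : pd i (fun y => φ (f y)) x = φ' * pd i f x := by
  have := (hφ.comp_hasFDerivAt x hf.hasFDerivAt).fderiv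
  simp only [Function.comp_def] at this
  simp [pd, this]

theorem pd_congr (hfh : f =ᶠ[nhds x] h) (i : Fin n) : pd i f x = pd i h x := by
  simp [pd, hfh.fderiv_eq]

theorem _root_.ContDiff.pd {f : E n → ℝ} {m l : WithTop ℕ∞} (hf : ContDiff ℝ m f) (hml : l + 1 ≤ m)
    (i : Fin n) : ContDiff ℝ l (pd i f) :=
  (hf.fderiv_right hml).clm_apply contDiff_const

theorem pd_comm (hf : ContDiffAt ℝ 2 f x) (i j : Fin n) : pd i (pd j f) x = pd j (pd i f) x := by
  have hs := hf.isSymmSndFDerivAt (by simp)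
  have hd : DifferentiableAt ℝ (fderiv ℝ f) x :=
    (hf.fderiv_right (m := 1) (by norm_num)).differentiableAt (by simp)
  have key : ∀ a b : Fin n, KYamabe.pd a (KYamabe.pd b f) x
      = fderiv ℝ (fderiv ℝ f) x (EuclideanSpace.single a 1) (EuclideanSpace.single b 1) := by
    intro a b
    have h2 := (hd.hasFDerivAt.clm_apply (hasFDerivAt_const (EuclideanSpace.single b (1 : ℝ)) x))
    change fderiv ℝ (fun y => fderiv ℝ f y (EuclideanSpace.single b 1)) x _ = _
    rw [h2.fderiv]
    simp
  rw [key, key, hs.eq]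

end Calculus

section ConformallyFlat

variable {n : ℕ} {f : E n → ℝ}

/-- With the conformal factor written as e^{2f}, the exponentials from g⁻¹ and ∂g cancel and only
first derivatives of f remain. -/
theorem christoffel_exp (hf : ContDiff ℝ 2 f) (l i j : Fin n) :
    christoffel (fun y => Real.exp (2 * f y) • (1 : Matrix (Fin n) (Fin n) ℝ)) l i j
      = fun x => (1 : Matrix (Fin n) (Fin n) ℝ) l j * pd i f x
          + (1 : Matrix (Fin n) (Fin n) ℝ) l i * pd j f x
          - (1 : Matrix (Fin n) (Fin n) ℝ) i j * pd l f x := by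
  ext x
  have hd : DifferentiableAt ℝ f x := hf.differentiable (by simp) x
  have hp : ∀ i a b : Fin n,
      pd i (fun y => Real.exp (2 * f y) * (1 : Matrix (Fin n) (Fin n) ℝ) a b) x
        = (1 : Matrix (Fin n) (Fin n) ℝ) a b * (Real.exp (2 * f x) * (2 * pd i f x)) := by
    intro i a b
    have h1 : HasDerivAt (fun t => (1 : Matrix (Fin n) (Fin n) ℝ) a b * Real.exp (2 * t))
        ((1 : Matrix (Fin n) (Fin n) ℝ) a b * (Real.exp (2 * f x) * (2 * 1))) (f x) :=
      (((hasDerivAt_id (f x)).const_mul 2).exp).const_mul _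
    have h2 := pd_comp h1 hd i
    have h3 : (fun y => Real.exp (2 * f y) * (1 : Matrix (Fin n) (Fin n) ℝ) a b)
        = fun y => (1 : Matrix (Fin n) (Fin n) ℝ) a b * Real.exp (2 * f y) := by
      ext y; ring
    rw [h3, h2]; ring
  have hinv : (Real.exp (2 * f x) • (1 : Matrix (Fin n) (Fin n) ℝ))⁻¹
      = (Real.exp (2 * f x))⁻¹ • (1 : Matrix (Fin n) (Fin n) ℝ) := by
    apply Matrix.inv_eq_left_inv
    simp [smul_smul, Real.exp_ne_zero]
  have hne := Real.exp_ne_zero (2 * f x)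
  simp only [christoffel, hp, hinv, Matrix.smul_apply, smul_eq_mul]
  rw [Finset.sum_eq_single l]
  · rw [Matrix.one_apply_eq]
    field_simp
  · intro b _ hb
    rw [Matrix.one_apply_ne hb.symm]; simp
  · simp

theorem sum_ite_const_zero (c : Prop) [Decidable c] (F : Fin n → ℝ) :
    ∑ m, (if c then F m else 0) = if c then ∑ m, F m else 0 := by
  split_ifs <;> simp

/-- The quadratic ΓΓ part of the Ricci tensor of e^{2f}|dx|², with a standing for df. -/
theorem sum_christoffel_mul (a : Fin n → ℝ) (i j : Fin n) :
    ∑ l, ∑ m, (((1 : Matrix (Fin n) (Fin n) ℝ) l m * a l + (1 : Matrix (Fin n) (Fin n) ℝ) l l * a m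
          - (1 : Matrix (Fin n) (Fin n) ℝ) l m * a l)
        * ((1 : Matrix (Fin n) (Fin n) ℝ) m j * a i + (1 : Matrix (Fin n) (Fin n) ℝ) m i * a j
          - (1 : Matrix (Fin n) (Fin n) ℝ) i j * a m)
      - ((1 : Matrix (Fin n) (Fin n) ℝ) l m * a j + (1 : Matrix (Fin n) (Fin n) ℝ) l j * a m
          - (1 : Matrix (Fin n) (Fin n) ℝ) j m * a l)
        * ((1 : Matrix (Fin n) (Fin n) ℝ) m l * a i + (1 : Matrix (Fin n) (Fin n) ℝ) m i * a l
          - (1 : Matrix (Fin n) (Fin n) ℝ) i l * a m))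
      = ((n : ℝ) - 2) * (a i * a j)
        - ((n : ℝ) - 2) * (∑ m, a m ^ 2) * (1 : Matrix (Fin n) (Fin n) ℝ) i j := by
  by_cases hij : i = j
  · subst hij
    simp only [Matrix.one_apply, if_true, mul_add, add_mul, mul_sub, sub_mul, ite_mul, mul_ite,
      one_mul, zero_mul, mul_one, mul_zero, Finset.sum_add_distrib, Finset.sum_sub_distrib,
      Finset.sum_ite_eq, Finset.sum_ite_eq', Finset.mem_univ, Finset.sum_const, Finset.card_univ,
      Fintype.card_fin, nsmul_eq_mul, sum_ite_const_zero, ← pow_two]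
    ring
  · simp only [Matrix.one_apply, if_true, mul_add, add_mul, mul_sub, sub_mul, ite_mul, mul_ite,
      one_mul, zero_mul, mul_zero, Finset.sum_add_distrib, Finset.sum_sub_distrib,
      Finset.sum_ite_eq, Finset.sum_ite_eq', Finset.mem_univ, Finset.sum_const, Finset.card_univ,
      Fintype.card_fin, nsmul_eq_mul, sum_ite_const_zero, hij, Ne.symm hij, if_false]
    ring

theorem ricci_exp (hf : ContDiff ℝ 2 f) (x : E n) (i j : Fin n) :
    ricci (fun y => Real.exp (2 * f y) • (1 : Matrix (Fin n) (Fin n) ℝ)) x i j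
      = -((n : ℝ) - 2) * (pd i (pd j f) x - pd i f x * pd j f x)
        - (∑ m, pd m (pd m f) x + ((n : ℝ) - 2) * ∑ m, pd m f x ^ 2)
          * (1 : Matrix (Fin n) (Fin n) ℝ) i j := by
  have hd : ∀ m, DifferentiableAt ℝ (pd m f) x := fun m =>
    (hf.pd (l := 1) (by norm_num) m).differentiable (by simp) x
  have hp : ∀ (a b c : ℝ) (p q r s : Fin n),
      pd s (fun y => a * pd p f y + b * pd q f y - c * pd r f y) x
        = a * pd s (pd p f) x + b * pd s (pd q f) x - c * pd s (pd r f) x := by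
    intro a b c p q r s
    rw [pd_sub (((hd p).const_mul a).fun_add ((hd q).const_mul b)) ((hd r).const_mul c),
      pd_add ((hd p).const_mul a) ((hd q).const_mul b), pd_const_mul a (hd p),
      pd_const_mul b (hd q), pd_const_mul c (hd r)]
  have hcomm := pd_comm (hf.contDiffAt (x := x))
  have hsum := sum_christoffel_mul (fun m => pd m f x) i j
  simp only [ricci, Matrix.of_apply, christoffel_exp hf, hp]
  rw [hsum]
  have hlin : ∑ l, ((1 : Matrix (Fin n) (Fin n) ℝ) l j * pd l (pd i f) x
        + (1 : Matrix (Fin n) (Fin n) ℝ) l i * pd l (pd j f) x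
        - (1 : Matrix (Fin n) (Fin n) ℝ) i j * pd l (pd l f) x
        - ((1 : Matrix (Fin n) (Fin n) ℝ) l l * pd j (pd i f) x
          + (1 : Matrix (Fin n) (Fin n) ℝ) l i * pd j (pd l f) x
          - (1 : Matrix (Fin n) (Fin n) ℝ) i l * pd j (pd l f) x))
      = -((n : ℝ) - 2) * pd i (pd j f) x
        - (∑ m, pd m (pd m f) x) * (1 : Matrix (Fin n) (Fin n) ℝ) i j := by
    simp only [Matrix.one_apply, if_true, ite_mul, one_mul, zero_mul, Finset.sum_add_distrib,
      Finset.sum_sub_distrib, Finset.sum_ite_eq, Finset.sum_ite_eq', Finset.mem_univ,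
      Finset.sum_const, Finset.card_univ, Fintype.card_fin, nsmul_eq_mul, sum_ite_const_zero, mul_ite, mul_one,
      mul_zero, hcomm j i]
    ring
  rw [hlin]
  ring

/-- The Schouten tensor of `e^{2f} |dx|²`. -/
theorem schouten_exp (hn : 3 ≤ n) (hf : ContDiff ℝ 2 f) (x : E n) :
    schouten (fun y => Real.exp (2 * f y) • (1 : Matrix (Fin n) (Fin n) ℝ)) x
      = Matrix.of fun i j => -pd i (pd j f) x + pd i f x * pd j f x
          - (1 / 2) * (∑ m, pd m f x ^ 2) * (1 : Matrix (Fin n) (Fin n) ℝ) i j := by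
  have hn' : (3 : ℝ) ≤ n := by exact_mod_cast hn
  have h2 : (n : ℝ) - 2 ≠ 0 := by linarith
  have h1 : (n : ℝ) - 1 ≠ 0 := by linarith
  have hne := Real.exp_ne_zero (2 * f x)
  have hinv : (Real.exp (2 * f x) • (1 : Matrix (Fin n) (Fin n) ℝ))⁻¹
      = (Real.exp (2 * f x))⁻¹ • (1 : Matrix (Fin n) (Fin n) ℝ) := by
    apply Matrix.inv_eq_left_inv
    simp [smul_smul, Real.exp_ne_zero]
  have hR : scalarCurvature (fun y => Real.exp (2 * f y) • (1 : Matrix (Fin n) (Fin n) ℝ)) x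
      = (Real.exp (2 * f x))⁻¹ * (-((n : ℝ) - 1) * (2 * ∑ m, pd m (pd m f) x
          + ((n : ℝ) - 2) * ∑ m, pd m f x ^ 2)) := by
    simp only [scalarCurvature, ricci_exp hf, hinv, Matrix.smul_apply, smul_eq_mul,
      Matrix.one_apply, mul_ite, ite_mul, mul_one, mul_zero, zero_mul, Finset.sum_ite_eq,
      Finset.mem_univ, if_true]
    rw [← Finset.mul_sum]
    congr 1
    simp only [Finset.sum_sub_distrib, ← Finset.mul_sum, Finset.sum_const, Finset.card_univ,
      Fintype.card_fin, nsmul_eq_mul, ← pow_two]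
    ring
  ext i j
  simp only [schouten, hR, Matrix.smul_apply, Matrix.sub_apply, ricci_exp hf, smul_eq_mul,
    Matrix.of_apply]
  field_simp
  ring

end ConformallyFlat

end KYamabe

/-! ## Radial calculus -/

namespace KYamabe

variable {n : ℕ}

theorem gradient_apply (f : E n → ℝ) (x : E n) (i : Fin n) : gradient f x i = pd i f x := by
  have h := InnerProductSpace.toDual_symm_apply (𝕜 := ℝ) (x := EuclideanSpace.single i (1 : ℝ))
    (y := fderiv ℝ f x)
  rw [real_inner_comm, EuclideanSpace.inner_single_left] at h
  simpa [gradient, pd] using h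

theorem norm_gradient_sq (f : E n → ℝ) (x : E n) : ‖gradient f x‖ ^ 2 = ∑ m, pd m f x ^ 2 := by
  simp [EuclideanSpace.real_norm_sq_eq, gradient_apply]

/-- The logarithm of the square root of the conformal factor of `g_u`. -/
noncomputable def logFactor (k : ℕ) (u : E n → ℝ) (x : E n) : ℝ :=
  2 * (k : ℝ) / ((n : ℝ) + 2 * k) * Real.log (u x)

theorem vOf_eq_exp {k : ℕ} {u : E n → ℝ} (hu : ∀ x, 0 < u x) :
    vOf k u = fun x => Real.exp (-logFactor k u x) := by
  ext x
  rw [vOf, Real.rpow_def_of_pos (hu x), logFactor]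
  congr 1; ring

theorem conformalMetric_eq_exp {k : ℕ} {u : E n → ℝ} (hu : ∀ x, 0 < u x) :
    conformalMetric k u
      = fun x => Real.exp (2 * logFactor k u x) • (1 : Matrix (Fin n) (Fin n) ℝ) := by
  ext1 x
  rw [conformalMetric, Real.rpow_def_of_pos (hu x), logFactor]
  congr 2; ring

theorem contDiff_logFactor {k : ℕ} {u : E n → ℝ} {l : WithTop ℕ∞} (hu : ∀ x, 0 < u x)
    (hc : ContDiff ℝ l u) : ContDiff ℝ l (logFactor k u) :=
  contDiff_const.mul (hc.log fun x => (hu x).ne')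

/-- For `g_u = v⁻² |dx|²` one has `g⁻¹ A_g = v D²v - ½ |Dv|² I`. -/
theorem sigmaMetric_conformalMetric {k : ℕ} {u : E n → ℝ} (hn : 3 ≤ n) (hu : ∀ x, 0 < u x)
    (hc : ContDiff ℝ 2 u) (j : ℕ) (x : E n) :
    sigmaMetric j (conformalMetric k u) x
      = sigma j (vOf k u x • hess (vOf k u) x
          - (‖gradient (vOf k u) x‖ ^ 2 / 2) • (1 : Matrix (Fin n) (Fin n) ℝ)) := by
  set f := logFactor k u with hf
  have hfc : ContDiff ℝ 2 f := contDiff_logFactor hu hc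
  have hd : ∀ y, DifferentiableAt ℝ f y := fun y => hfc.differentiable (by simp) y
  have hdd : ∀ m, DifferentiableAt ℝ (pd m f) x := fun m =>
    (hfc.pd (l := 1) (by norm_num) m).differentiable (by simp) x
  rw [norm_gradient_sq, sigmaMetric, conformalMetric_eq_exp hu, schouten_exp hn hfc,
    vOf_eq_exp hu, ← hf]
  have hder : ∀ t : ℝ, HasDerivAt (fun t => Real.exp (-t)) (-Real.exp (-t)) t := fun t => by
    simpa using (hasDerivAt_neg t).exp
  have hexp : ∀ y, DifferentiableAt ℝ (fun y => Real.exp (-f y)) y := fun y => (hd y).neg.exp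
  have h1 : ∀ m, pd m (fun y => Real.exp (-f y)) = fun y => (-1) * (Real.exp (-f y) * pd m f y) := by
    intro m; ext y
    rw [pd_comp (hder (f y)) (hd y)]; ring
  have hinv : (Real.exp (2 * f x) • (1 : Matrix (Fin n) (Fin n) ℝ))⁻¹
      = (Real.exp (-f x) * Real.exp (-f x)) • (1 : Matrix (Fin n) (Fin n) ℝ) := by
    apply Matrix.inv_eq_left_inv
    rw [smul_mul_smul_comm, one_mul, ← Real.exp_add, ← Real.exp_add]
    simp [show -f x + -f x + 2 * f x = 0 by ring]
  congr 1
  rw [hinv, smul_mul_assoc, one_mul]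
  ext i j
  simp only [Matrix.smul_apply, Matrix.sub_apply, Matrix.of_apply, hess, smul_eq_mul]
  have h2 : pd i (pd j fun y => Real.exp (-f y)) x
      = (-1) * (Real.exp (-f x) * pd i (pd j f) x + pd j f x * ((-1) * (Real.exp (-f x) * pd i f x))) := by
    rw [h1 j, pd_const_mul (-1) ((hexp x).fun_mul (hdd j)), pd_mul (hexp x) (hdd j), h1 i]
  rw [h2]
  simp only [h1, mul_pow, ← Finset.mul_sum]
  ring

section Radial

variable {v : E n → ℝ} {U : ℝ → ℝ} {x : E n}

theorem pd_comp_norm_sq (hU : DifferentiableAt ℝ U (‖x‖ ^ 2)) (i : Fin n) :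
    pd i (fun y => U (‖y‖ ^ 2)) x = 2 * x i * deriv U (‖x‖ ^ 2) := by
  have hd : DifferentiableAt ℝ (fun y : E n => ‖y‖ ^ 2) x :=
    (contDiff_norm_sq ℝ (n := 1)).differentiable (by simp) x
  rw [pd_comp hU.hasDerivAt hd]
  have := (hasStrictFDerivAt_norm_sq x).hasFDerivAt.fderiv
  rw [pd, this]
  simp [EuclideanSpace.inner_single_right]
  ring

theorem hess_comp_norm_sq (hU : ContDiffAt ℝ 2 U (‖x‖ ^ 2)) :
    hess (fun y => U (‖y‖ ^ 2)) x
      = (2 * deriv U (‖x‖ ^ 2)) • (1 : Matrix (Fin n) (Fin n) ℝ)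
        + (4 * deriv (deriv U) (‖x‖ ^ 2)) • Matrix.vecMulVec x x := by
  have hd : Differentiable ℝ (fun y : E n => ‖y‖ ^ 2) :=
    (contDiff_norm_sq ℝ (n := 1)).differentiable (by simp)
  have hU1 : DifferentiableAt ℝ (deriv U) (‖x‖ ^ 2) :=
    (hU.derivWithin (m := 1) (by norm_num)).differentiableAt (by simp)
  have hev : ∀ᶠ y in nhds x, DifferentiableAt ℝ U (‖y‖ ^ 2) :=
    hd.continuous.continuousAt.eventually
      ((hU.eventually (by simp)).mono fun t ht => ht.differentiableAt (by simp))
  ext i j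
  have h1 : pd j (fun y => U (‖y‖ ^ 2)) =ᶠ[nhds x] fun y => (2 * y j) * deriv U (‖y‖ ^ 2) :=
    hev.mono fun y hy => pd_comp_norm_sq hy j
  have h2 : HasFDerivAt (fun y : E n => y j) (EuclideanSpace.proj (𝕜 := ℝ) j : E n →L[ℝ] ℝ) x :=
    (EuclideanSpace.proj (𝕜 := ℝ) j : E n →L[ℝ] ℝ).hasFDerivAt
  have h3 : pd i (fun y : E n => y j) x = (1 : Matrix (Fin n) (Fin n) ℝ) i j := by
    rw [pd, h2.fderiv]
    simp [Matrix.one_apply, eq_comm]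
  have hdj : DifferentiableAt ℝ (fun y : E n => 2 * y j) x := h2.differentiableAt.const_mul 2
  have hdU : DifferentiableAt ℝ (fun y : E n => deriv U (‖y‖ ^ 2)) x := 
    DifferentiableAt.comp (g := deriv U) x hU1 (hd x)
  have h4 : hess (fun y => U (‖y‖ ^ 2)) x i j
      = (2 * x j) * (2 * x i * deriv (deriv U) (‖x‖ ^ 2))
        + deriv U (‖x‖ ^ 2) * (2 * (1 : Matrix (Fin n) (Fin n) ℝ) i j) := by
    rw [hess, Matrix.of_apply, pd_congr h1, pd_mul hdj hdU,
      pd_comp_norm_sq hU1, pd_const_mul 2 h2.differentiableAt, h3]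
  rw [h4]
  simp only [Matrix.add_apply, Matrix.smul_apply, smul_eq_mul, Matrix.vecMulVec_apply]
  ring

theorem norm_gradient_comp_norm_sq (hU : DifferentiableAt ℝ U (‖x‖ ^ 2)) :
    ‖gradient (fun y => U (‖y‖ ^ 2)) x‖ ^ 2 = 4 * ‖x‖ ^ 2 * deriv U (‖x‖ ^ 2) ^ 2 := by
  rw [norm_gradient_sq]
  simp only [pd_comp_norm_sq hU, mul_pow, EuclideanSpace.real_norm_sq_eq x]
  rw [← Finset.sum_mul, ← Finset.mul_sum]
  ring

theorem inner_gradient_comp_norm_sq (hU : DifferentiableAt ℝ U (‖x‖ ^ 2)) :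
    inner ℝ x (gradient (fun y => U (‖y‖ ^ 2)) x) = 2 * ‖x‖ ^ 2 * deriv U (‖x‖ ^ 2) := by
  rw [PiLp.inner_apply]
  simp only [gradient_apply, pd_comp_norm_sq hU, EuclideanSpace.real_norm_sq_eq x]
  simp only [RCLike.inner_apply, conj_trivial, Finset.mul_sum, Finset.sum_mul]
  refine Finset.sum_congr rfl fun i _ => ?_
  ring

end Radial

end KYamabe

/-! ## The equation in the radial variable -/

namespace KYamabe

variable {n : ℕ}

/-- The `(j+1)`-st elementary symmetric function of the `n` numbers `a, b, …, b`. -/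
noncomputable def radialSigma (n j : ℕ) (a b : ℝ) : ℝ :=
  ((n - 1).choose (j + 1) : ℝ) * b ^ (j + 1) + a * (((n - 1).choose j : ℝ) * b ^ j)

theorem radialSigma_mul (n j : ℕ) (a b c : ℝ) :
    radialSigma n j (c * a) (c * b) = c ^ (j + 1) * radialSigma n j a b := by
  simp only [radialSigma, mul_pow, pow_succ]; ring

theorem hess_congr {f h : E n → ℝ} {x : E n} (hfh : f =ᶠ[nhds x] h) : hess f x = hess h x := by
  ext i j
  have : pd j f =ᶠ[nhds x] pd j h := hfh.eventuallyEq_nhds.mono fun y hy => pd_congr hy j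
  exact pd_congr this i

theorem gradient_congr {f h : E n → ℝ} {x : E n} (hfh : f =ᶠ[nhds x] h) :
    gradient f x = gradient h x := by
  simp [gradient, hfh.fderiv_eq]

section Profile

variable {k : ℕ} {u : E n → ℝ} {S : ℝ → ℝ} {x : E n}

theorem vOf_eventuallyEq (hk : 0 < k)
    (huS : ∀ᶠ y in nhds x, u y = Real.exp (-(((n : ℝ) + 2 * k) / (2 * k)) * S (‖y‖ ^ 2))) :
    vOf k u =ᶠ[nhds x] fun y => Real.exp (S (‖y‖ ^ 2)) := by
  filter_upwards [huS] with y hy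
  have hk' : (0 : ℝ) < k := by exact_mod_cast hk
  have hnk : (0 : ℝ) < (n : ℝ) + 2 * k := by positivity
  rw [vOf, hy, ← Real.exp_mul]
  congr 1
  field_simp

theorem deriv_exp_comp {τ : ℝ} (hS : DifferentiableAt ℝ S τ) (c : ℝ) :
    deriv (fun t => Real.exp (c * S t)) τ = c * (deriv S τ * Real.exp (c * S τ)) := by
  rw [((hS.hasDerivAt.const_mul c).exp).deriv]; ring

theorem deriv_deriv_exp_comp {τ : ℝ} (hS : ContDiffAt ℝ 2 S τ) :
    deriv (deriv fun t => Real.exp (S t)) τ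
      = (deriv S τ ^ 2 + deriv (deriv S) τ) * Real.exp (S τ) := by
  have hev : deriv (fun t => Real.exp (S t)) =ᶠ[nhds τ] fun t => deriv S t * Real.exp (S t) := by
    filter_upwards [hS.eventually (by simp)] with t ht
    simpa using deriv_exp_comp (ht.differentiableAt (by simp)) 1
  have hS1 : DifferentiableAt ℝ (deriv S) τ :=
    (hS.derivWithin (m := 1) (by norm_num)).differentiableAt (by simp)
  have hd := hS.differentiableAt (by simp)
  rw [hev.deriv_eq, (hS1.hasDerivAt.fun_mul hd.hasDerivAt.exp).deriv]
  ring

/-- The matrix `v D²v - ½ |Dv|² I` for `v = exp (S (|x|²))`. -/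
theorem hess_sub_norm_gradient_exp (hS : ContDiffAt ℝ 2 S (‖x‖ ^ 2)) {c d : ℝ} :
    c • hess (fun y => Real.exp (S (‖y‖ ^ 2))) x
        - (d * ‖gradient (fun y => Real.exp (S (‖y‖ ^ 2))) x‖ ^ 2)
          • (1 : Matrix (Fin n) (Fin n) ℝ)
      = (c * (2 * deriv S (‖x‖ ^ 2) * Real.exp (S (‖x‖ ^ 2)))
          - d * (4 * ‖x‖ ^ 2 * (deriv S (‖x‖ ^ 2) * Real.exp (S (‖x‖ ^ 2))) ^ 2))
          • (1 : Matrix (Fin n) (Fin n) ℝ)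
        + (c * (4 * ((deriv S (‖x‖ ^ 2) ^ 2 + deriv (deriv S) (‖x‖ ^ 2)) * Real.exp (S (‖x‖ ^ 2)))))
          • Matrix.vecMulVec x x := by
  have hU : ContDiffAt ℝ 2 (fun t => Real.exp (S t)) (‖x‖ ^ 2) := hS.exp
  have h1 := deriv_exp_comp (hS.differentiableAt (by simp)) 1
  simp only [one_mul] at h1
  rw [hess_comp_norm_sq (U := fun t => Real.exp (S t)) hU,
    norm_gradient_comp_norm_sq (U := fun t => Real.exp (S t)) (hU.differentiableAt (by simp)),
    h1, deriv_deriv_exp_comp hS]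
  ext i j
  simp only [Matrix.add_apply, Matrix.sub_apply, Matrix.smul_apply, smul_eq_mul]
  ring

theorem dotProduct_self (x : E n) : (x : Fin n → ℝ) ⬝ᵥ (x : Fin n → ℝ) = ‖x‖ ^ 2 := by
  rw [EuclideanSpace.real_norm_sq_eq]
  simp [dotProduct, pow_two]

/-- Here v = e^S, and v D²v − ½|Dv|² I equals e^{2S} times (b I + 4(S'² + S'') x xᵀ). The hypotheses
on S are local at ‖x‖², because a profile extracted from a given solution is only known to be C²
away from τ = 0. -/
theorem sigmaMetric_eq_radialSigma (hn : 3 ≤ n) (hk : 0 < k) (hu : ∀ x, 0 < u x)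
    (hc : ContDiff ℝ 2 u) (hS : ContDiffAt ℝ 2 S (‖x‖ ^ 2))
    (huS : ∀ᶠ y in nhds x, u y = Real.exp (-(((n : ℝ) + 2 * k) / (2 * k)) * S (‖y‖ ^ 2)))
    (j : ℕ) {τ s1 s2 b : ℝ} (hτ : τ = ‖x‖ ^ 2) (h1 : s1 = deriv S τ) (h2 : s2 = deriv (deriv S) τ)
    (hb : b = 2 * s1 * (1 - τ * s1)) :
    sigmaMetric (j + 1) (conformalMetric k u) x
      = (Real.exp (S τ) ^ 2) ^ (j + 1) * radialSigma n j (b + 4 * τ * (s1 ^ 2 + s2)) b := by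
  have hv := vOf_eventuallyEq hk huS
  have := hess_sub_norm_gradient_exp hS (c := Real.exp (S (‖x‖ ^ 2))) (d := 1 / 2)
  rw [sigmaMetric_conformalMetric hn hu hc, hess_congr hv, gradient_congr hv, hv.eq_of_nhds,
    div_eq_inv_mul, inv_eq_one_div, this, sigma_smul_one_add_vecMulVec (by omega), dotProduct_self,
    ← radialSigma_mul]
  subst hτ h1 h2 hb
  unfold radialSigma
  ring

/-- Compared with g⁻¹A_g, the matrix in the equation lacks one factor v = e^S, hence e^{kS} in place
of e^{2kS}. On the right, x · Du contributes the logarithmic derivative 2τS' of v. -/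
theorem ellipticEq_iff (hk : 0 < k) (hn : 3 ≤ n) (hS : ContDiffAt ℝ 2 S (‖x‖ ^ 2))
    (huS : ∀ᶠ y in nhds x, u y = Real.exp (-(((n : ℝ) + 2 * k) / (2 * k)) * S (‖y‖ ^ 2)))
    {θ ρ τ s1 s2 b : ℝ} (hτ : τ = ‖x‖ ^ 2) (h1 : s1 = deriv S τ) (h2 : s2 = deriv (deriv S) τ)
    (hb : b = 2 * s1 * (1 - τ * s1)) :
    EllipticEq k θ ρ u x ↔
      (Real.exp (S τ) ^ k * radialSigma n (k - 1) (b + 4 * τ * (s1 ^ 2 + s2)) b) ^ (1 / (k : ℝ))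
        = (Real.exp (S τ))⁻¹ * (2 * θ + ρ - 4 * θ * τ * s1) := by
  have hk' : (0 : ℝ) < k := by exact_mod_cast hk
  have hnk : (0 : ℝ) < (n : ℝ) + 2 * k := by positivity
  have hv := vOf_eventuallyEq hk huS
  have hux := huS.self_of_nhds
  have hupow : u x ^ (2 * (k : ℝ) / ((n : ℝ) + 2 * k)) = (Real.exp (S (‖x‖ ^ 2)))⁻¹ := by
    rw [hux, ← Real.exp_mul, ← Real.exp_neg]
    congr 1
    field_simp
  have hupos : 0 < u x := by rw [hux]; exact Real.exp_pos _
  have hgrad : inner ℝ x (gradient u x) = 2 * ‖x‖ ^ 2 *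
      (-(((n : ℝ) + 2 * k) / (2 * k)) * (deriv S (‖x‖ ^ 2) * u x)) := by
    rw [gradient_congr huS, inner_gradient_comp_norm_sq
      (U := fun t => Real.exp (-(((n : ℝ) + 2 * k) / (2 * k)) * S t))
      ((hS.differentiableAt (by simp)).const_mul _).exp,
      deriv_exp_comp (hS.differentiableAt (by simp)), hux]
  have hRHS : u x ^ (2 * (k : ℝ) / ((n : ℝ) + 2 * k) - 1) *
      ((2 * θ + ρ) * u x + 4 * (k : ℝ) * θ / ((n : ℝ) + 2 * k) * inner ℝ x (gradient u x))
      = (Real.exp (S τ))⁻¹ * (2 * θ + ρ - 4 * θ * τ * s1) := by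
    rw [Real.rpow_sub hupos, Real.rpow_one, hupow, hgrad, ← hτ, h1]
    field_simp
    ring
  have := hess_sub_norm_gradient_exp hS (c := 1) (d := (Real.exp (S (‖x‖ ^ 2)))⁻¹ / 2)
  rw [one_smul] at this
  obtain ⟨j, rfl⟩ : ∃ j, k = j + 1 := ⟨k - 1, by omega⟩
  rw [EllipticEq, hRHS, hess_congr hv, gradient_congr hv, hupow, this,
    sigma_smul_one_add_vecMulVec (by omega), dotProduct_self, Nat.add_sub_cancel,
    ← radialSigma_mul]
  have hne := Real.exp_ne_zero (S (‖x‖ ^ 2))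
  have e1 : (1 * (2 * deriv S (‖x‖ ^ 2) * Real.exp (S (‖x‖ ^ 2)))
      - (Real.exp (S (‖x‖ ^ 2)))⁻¹ / 2 *
        (4 * ‖x‖ ^ 2 * (deriv S (‖x‖ ^ 2) * Real.exp (S (‖x‖ ^ 2))) ^ 2))
      = Real.exp (S τ) * b := by
    subst hτ h1 h2 hb
    field_simp
    ring
  rw [e1]
  subst hτ h1 h2
  unfold radialSigma
  ring_nf

end Profile

end KYamabe

/-! ## Nonexistence -/

namespace KYamabe

/-- If g stayed below P < 2, then, g being nondecreasing, g' would be at least the constant c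
g(0)(2−P) for t ≥ 0, and g would pass 2 in finite time. -/
theorem exists_gt_of_logistic_ineq {g g' : ℝ → ℝ} {c : ℝ} (hc : 0 < c)
    (hg : ∀ t, HasDerivAt g (g' t) t) (hg' : ∀ t, c * (g t * (2 - g t)) ≤ g' t)
    (h0 : ∀ t, 0 < g t) (h2 : ∀ t, g t < 2) {P : ℝ} (hP : P < 2) : ∃ t, P < g t := by
  by_contra! hcon
  have hnn : ∀ t, 0 ≤ g' t := fun t =>
    le_trans (mul_nonneg hc.le (mul_nonneg (h0 t).le (by linarith [h2 t]))) (hg' t)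
  have hmono : Monotone g := monotone_of_hasDerivAt_nonneg hg hnn
  set m := c * (g 0 * (2 - P)) with hm
  have hmpos : 0 < m := mul_pos hc (mul_pos (h0 0) (by linarith))
  have hlow : ∀ t, 0 ≤ t → m ≤ g' t := by
    intro t ht
    refine le_trans ?_ (hg' t)
    have h1 : g 0 ≤ g t := hmono ht
    have h3 : 2 - P ≤ 2 - g t := by linarith [hcon t]
    rw [hm]
    exact mul_le_mul_of_nonneg_left (mul_le_mul h1 h3 (by linarith) (h0 t).le) hc.le
  have hmono2 : MonotoneOn (fun t => g t - m * t) (Set.Ici 0) := by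
    have hd : ∀ t, HasDerivAt (fun t => g t - m * t) (g' t - m * 1) t := fun t =>
      (hg t).sub ((hasDerivAt_id t).const_mul m)
    refine monotoneOn_of_deriv_nonneg (convex_Ici 0)
      (fun t _ => (hd t).continuousAt.continuousWithinAt)
      (fun t _ => (hd t).differentiableAt.differentiableWithinAt) fun t ht => ?_
    rw [interior_Ici, Set.mem_Ioi] at ht
    rw [(hd t).deriv]
    linarith [hlow t ht.le]
  have := hmono2 (Set.mem_Ici.2 le_rfl) (Set.mem_Ici.2 (by positivity : (0 : ℝ) ≤ 2 / m))
    (by positivity)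
  have h4 : m * (2 / m) = 2 := by field_simp
  simp only [mul_zero, sub_zero, h4] at this
  linarith [h2 (2 / m), h0 0]

/-- The logistic inequality is invariant under g(t) ↦ 2 − g(−t), which exchanges the two ends. -/
theorem exists_lt_of_logistic_ineq {g g' : ℝ → ℝ} {c : ℝ} (hc : 0 < c)
    (hg : ∀ t, HasDerivAt g (g' t) t) (hg' : ∀ t, c * (g t * (2 - g t)) ≤ g' t)
    (h0 : ∀ t, 0 < g t) (h2 : ∀ t, g t < 2) {P : ℝ} (hP : 0 < P) : ∃ t, g t < P := by
  have hd : ∀ t, HasDerivAt (fun t => 2 - g (-t)) (g' (-t)) t := fun t => by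
    have := ((hg (-t)).comp t (hasDerivAt_neg t)).const_sub 2
    simpa [Function.comp_def] using this
  obtain ⟨t, ht⟩ := exists_gt_of_logistic_ineq hc hd
    (fun t => by have := hg' (-t); convert this using 2; ring)
    (fun t => by linarith [h2 (-t)]) (fun t => by linarith [h0 (-t)]) (P := 2 - P) (by linarith)
  exact ⟨-t, by linarith⟩

theorem choose_succ_mul (n k : ℕ) (hkn : k ≤ n) (hk : 0 < k) :
    (k : ℝ) * ((n - 1).choose k : ℝ) = ((n : ℝ) - k) * ((n - 1).choose (k - 1) : ℝ) := by
  obtain ⟨j, rfl⟩ : ∃ j, k = j + 1 := ⟨k - 1, by omega⟩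
  obtain ⟨N, rfl⟩ : ∃ N, n = N + 1 := ⟨n - 1, by omega⟩
  have h := Nat.choose_succ_right_eq N j
  have h2 : (N.choose (j + 1) : ℝ) * ((j : ℝ) + 1) = N.choose j * ((N - j : ℕ) : ℝ) := by
    exact_mod_cast h
  rw [Nat.cast_sub (by omega)] at h2
  simp only [Nat.add_sub_cancel]
  push_cast
  linarith

/-- The identity k C(n−1,k) = (n−k) C(n−1,k−1) lets b^{k−1} be factored out, so that for b > 0 the
sign of σ_k is that of a linear form in a and b. -/
theorem radialSigma_eq {n k : ℕ} (hkn : k ≤ n) (hk : 0 < k) (a b : ℝ) :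
    (k : ℝ) * radialSigma n (k - 1) a b
      = ((n - 1).choose (k - 1) : ℝ) * b ^ (k - 1) * (((n : ℝ) - k) * b + k * a) := by
  have h := choose_succ_mul n k hkn hk
  obtain ⟨j, rfl⟩ : ∃ j, k = j + 1 := ⟨k - 1, by omega⟩
  simp only [Nat.add_sub_cancel] at h ⊢
  unfold radialSigma
  rw [pow_succ, mul_add]
  linear_combination b ^ j * b * h

/-- In the cone `Γ_k⁺`, `k ≥ 2`, the repeated eigenvalue is positive. -/
theorem pos_of_radialSigma_pos {n k : ℕ} (hn : 3 ≤ n) (hkn : k ≤ n) (hk : 2 ≤ k) {a b : ℝ}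
    (h : ∀ j < k, 0 < radialSigma n j a b) : 0 < b ∧ 0 < ((n : ℝ) - k) * b + k * a := by
  have h1 := h 0 (by omega)
  have h2 := h 1 (by omega)
  have e1 := radialSigma_eq (n := n) (k := 1) (by omega) (by omega) a b
  have e2 := radialSigma_eq (n := n) (k := 2) (by omega) (by omega) a b
  have hn1 : (((n - 1 : ℕ)) : ℝ) = (n : ℝ) - 1 := by rw [Nat.cast_sub (by omega)]; simp
  have hn' : (3 : ℝ) ≤ n := by exact_mod_cast hn
  simp [hn1] at e1 e2
  rw [e1] at h1
  have hb : 0 < b := by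
    -- If b ≤ 0, then σ_1 = (n−1)b + a > 0 gives (n−2)b + 2a > −nb ≥ 0, so 2σ_2 = (n−1) b ((n−2)b +
    -- 2a) ≤ 0.
    by_contra! hb
    have h3 : 0 ≤ (n - 1) * (-b) * (((n : ℝ) - 2) * b + 2 * a) := by
      apply mul_nonneg
      · apply mul_nonneg <;> linarith
      · nlinarith
    nlinarith
  refine ⟨hb, ?_⟩
  have h3 := h (k - 1) (by omega)
  have e3 := radialSigma_eq hkn (by omega) a b
  have hk' : (0 : ℝ) < k := by exact_mod_cast (by omega : 0 < k)
  have h4 := mul_pos hk' h3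
  rw [e3] at h4
  exact (pos_iff_pos_of_mul_pos h4).1
    (mul_pos (by exact_mod_cast Nat.choose_pos (by omega)) (pow_pos hb _))

/-- The function g is p = 2τS' in the variable t = log τ. The bounds 0 < g < 2 express b > 0, the
differential inequality expresses (n−k)b + ka > 0, and the last condition is the sign of the right
side of the equation. -/
theorem exists_profile {n k : ℕ} (hn : 3 ≤ n) (hkn : k ≤ n) (hnk : n < 2 * k) {θ ρ : ℝ}
    {u : E n → ℝ} (hu : IsAdmissibleRadialSolution k θ ρ u) :
    ∃ g g' : ℝ → ℝ, (∀ t, HasDerivAt g (g' t) t) ∧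
      (∀ t, (2 * k - n) / (4 * k) * (g t * (2 - g t)) ≤ g' t) ∧
      (∀ t, 0 < g t) ∧ (∀ t, g t < 2) ∧ ∀ t, 0 < 2 * θ + ρ - 2 * θ * g t := by
  have hk : 0 < k := by omega
  have hk' : (0 : ℝ) < k := by exact_mod_cast hk
  have hnk' : (0 : ℝ) < (n : ℝ) + 2 * k := by positivity
  set e : E n := EuclideanSpace.single ⟨0, by omega⟩ 1 with he
  have hen : ‖e‖ = 1 := by simp [he]
  -- The profile is read along a ray through a square root, so its regularity is used only for τ >
  -- 0, which is exactly the range of τ = e^t.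
  set S : ℝ → ℝ := fun τ => -logFactor k u (Real.sqrt τ • e) with hSdef
  have huS : ∀ y : E n, u y = Real.exp (-(((n : ℝ) + 2 * k) / (2 * k)) * S (‖y‖ ^ 2)) := by
    intro y
    have h1 : u (Real.sqrt (‖y‖ ^ 2) • e) = u y := by
      apply hu.radial
      rw [norm_smul, hen, Real.sqrt_sq (norm_nonneg _)]; simp
    have h2 : -(((n : ℝ) + 2 * k) / (2 * k)) * S (‖y‖ ^ 2) = Real.log (u y) := by
      simp only [hSdef, logFactor, h1]
      field_simp
    rw [h2, Real.exp_log (hu.pos y)]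
  have hS : ∀ τ, 0 < τ → ContDiffAt ℝ 2 S τ := by
    intro τ hτ
    exact ((contDiff_logFactor hu.pos hu.contDiff).contDiffAt.comp τ
      ((Real.contDiffAt_sqrt hτ.ne').smul contDiffAt_const)).neg
  have hS1 : ∀ τ, 0 < τ → DifferentiableAt ℝ (deriv S) τ := fun τ hτ =>
    ((hS τ hτ).derivWithin (m := 1) (by norm_num)).differentiableAt (by simp)
  set p : ℝ → ℝ := fun τ => 2 * (τ * deriv S τ) with hp
  have hp' : ∀ τ, 0 < τ →
      HasDerivAt p (2 * (1 * deriv S τ + τ * deriv (deriv S) τ)) τ := fun τ hτ =>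
    ((hasDerivAt_id τ).mul (hS1 τ hτ).hasDerivAt).const_mul 2
  have key : ∀ τ, 0 < τ → 0 < p τ * (2 - p τ) ∧ 0 < 2 * θ + ρ - 2 * θ * p τ ∧
      (2 * k - n) / (4 * k) * (p τ * (2 - p τ))
        ≤ 2 * (1 * deriv S τ + τ * deriv (deriv S) τ) * τ := by
    intro τ hτ
    set x : E n := Real.sqrt τ • e with hx
    have hxτ : ‖x‖ ^ 2 = τ := by
      rw [hx, norm_smul, hen, mul_one, Real.norm_of_nonneg (Real.sqrt_nonneg _), Real.sq_sqrt hτ.le]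
    have hSx : ContDiffAt ℝ 2 S (‖x‖ ^ 2) := hxτ ▸ hS τ hτ
    have hux := Filter.Eventually.of_forall (f := nhds x) huS
    obtain ⟨s1, h1⟩ : ∃ s1, s1 = deriv S τ := ⟨_, rfl⟩
    obtain ⟨s2, h2⟩ : ∃ s2, s2 = deriv (deriv S) τ := ⟨_, rfl⟩
    obtain ⟨b, hb⟩ : ∃ b, b = 2 * s1 * (1 - τ * s1) := ⟨_, rfl⟩
    have hcone : ∀ j < k, 0 < radialSigma n j (b + 4 * τ * (s1 ^ 2 + s2)) b := by
      intro j hj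
      have h3 := hu.admissible (j + 1) (by omega) (by omega) x
      rw [sigmaMetric_eq_radialSigma hn hk hu.pos hu.contDiff hSx hux j hxτ.symm h1 h2 hb] at h3
      exact (pos_iff_pos_of_mul_pos h3).1 (by positivity)
    obtain ⟨hbpos, hab⟩ := pos_of_radialSigma_pos hn hkn (by omega) hcone
    have heq := (ellipticEq_iff hk hn hSx hux hxτ.symm h1 h2 hb).1 (hu.equation x)
    -- Admissibility makes the left side of the equation strictly positive.
    have hpos : 0 < (Real.exp (S τ))⁻¹ * (2 * θ + ρ - 4 * θ * τ * s1) := by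
      rw [← heq]
      exact Real.rpow_pos_of_pos (mul_pos (by positivity) (hcone _ (by omega))) _
    have hF := (pos_iff_pos_of_mul_pos hpos).1 (by positivity)
    simp only [hp, ← h1, ← h2]
    refine ⟨?_, by linarith, ?_⟩
    · have := mul_pos hτ hbpos
      rw [hb] at this
      linarith
    · rw [div_mul_eq_mul_div, div_le_iff₀ (by positivity)]
      have := mul_pos hτ hab
      rw [hb] at this
      linarith
  refine ⟨fun t => p (Real.exp t), fun t => 2 * (1 * deriv S (Real.exp t) +
    Real.exp t * deriv (deriv S) (Real.exp t)) * Real.exp t, fun t =>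
    (hp' _ (Real.exp_pos t)).comp t (Real.hasDerivAt_exp t),
    fun t => (key _ (Real.exp_pos t)).2.2, fun t => ?_, fun t => ?_,
    fun t => (key _ (Real.exp_pos t)).2.1⟩
  · have := (key _ (Real.exp_pos t)).1
    by_contra! h
    nlinarith
  · have := (key _ (Real.exp_pos t)).1
    by_contra! h
    nlinarith

/-- F(p) = 2θ + ρ − 2θp must be positive on all values of p. For θ > 0 the values near p = 2 force ρ
≥ 2θ. For θ < 0, any p < 2 gives ρ > 2θ, and a value p < 1 excludes ρ ≤ 0. -/
theorem two_theta_le_and_pos {n k : ℕ} (hn : 3 ≤ n) (hkn : k ≤ n) (hnk : n < 2 * k) {θ ρ : ℝ}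
    {u : E n → ℝ} (hu : IsAdmissibleRadialSolution k θ ρ u) : 2 * θ ≤ ρ ∧ 0 < ρ := by
  obtain ⟨g, g', hg, hg', h0, h2, hF⟩ := exists_profile hn hkn hnk hu
  have hk' : (0 : ℝ) < k := by exact_mod_cast (by omega : 0 < k)
  have hnk' : (n : ℝ) < 2 * k := by exact_mod_cast hnk
  have hc : 0 < (2 * (k : ℝ) - n) / (4 * k) := div_pos (by linarith) (by linarith)
  have hle : 2 * θ ≤ ρ := by
    by_contra! hlt
    rcases lt_trichotomy θ 0 with hθ | hθ | hθ
    · nlinarith [hF 0, h2 0]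
    · have := hF 0; subst hθ; linarith
    · obtain ⟨t, ht⟩ := exists_gt_of_logistic_ineq hc hg hg' h0 h2
        (P := (2 * θ + ρ) / (2 * θ)) (by rw [div_lt_iff₀ (by linarith)]; linarith)
      rw [div_lt_iff₀ (by linarith)] at ht
      linarith [hF t]
  refine ⟨hle, ?_⟩
  by_contra! hρ
  rcases lt_trichotomy θ 0 with hθ | hθ | hθ
  · obtain ⟨t, ht⟩ := exists_lt_of_logistic_ineq hc hg hg' h0 h2 (P := 1) one_pos
    nlinarith [hF t]
  · have := hF 0; subst hθ; linarith
  · linarith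

end KYamabe

/-! ## Weighted averages -/

namespace KYamabe

open Set

/-- The weighted average `∫₀¹ f (τ σ²) σ^m dσ`. -/
noncomputable def wavg (m : ℕ) (f : ℝ → ℝ) (τ : ℝ) : ℝ :=
  ∫ σ in (0 : ℝ)..1, f (τ * σ ^ 2) * σ ^ m

theorem abs_mul_sq_le {τ σ : ℝ} (hσ : σ ∈ Icc (0 : ℝ) 1) : |τ * σ ^ 2| ≤ |τ| := by
  rw [abs_mul, abs_of_nonneg (sq_nonneg σ)]
  exact mul_le_of_le_one_right (abs_nonneg _) (pow_le_one₀ hσ.1 hσ.2)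

theorem wavg_congr {m : ℕ} {f g : ℝ → ℝ} {τ r : ℝ} (hfg : ∀ s, |s| ≤ r → f s = g s)
    (hτ : |τ| ≤ r) : wavg m f τ = wavg m g τ := by
  refine intervalIntegral.integral_congr fun σ hσ => ?_
  rw [uIcc_of_le zero_le_one] at hσ
  simp only [hfg _ ((abs_mul_sq_le hσ).trans hτ)]

theorem continuous_wavg {m : ℕ} {f : ℝ → ℝ} (hf : Continuous f) : Continuous (wavg m f) := by
  unfold wavg
  exact intervalIntegral.continuous_parametric_intervalIntegral_of_continuous'
    (f := fun τ σ => f (τ * σ ^ 2) * σ ^ m) (by fun_prop) 0 1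

/-- A weighted average at τ sees f only on |s| ≤ |τ|, so f may be frozen outside [−r, r] and treated
as globally continuous. -/
theorem exists_continuous_eq {f : ℝ → ℝ} {δ τ : ℝ} (hf : ContinuousOn f (Ioo (-δ) δ))
    (hτ : τ ∈ Ioo (-δ) δ) : ∃ r, |τ| < r ∧ r < δ ∧ ∃ g : ℝ → ℝ, Continuous g ∧
      ∀ s, |s| ≤ r → g s = f s := by
  obtain ⟨r, h1, h2⟩ := exists_between (abs_lt.2 hτ)
  have hr : -r ≤ r := by linarith [abs_nonneg τ]
  refine ⟨r, h1, h2, fun s => f (projIcc (-r) r hr s), ?_, fun s hs => ?_⟩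
  · refine hf.comp_continuous (continuous_subtype_val.comp continuous_projIcc) fun s => ?_
    have := (projIcc (-r) r hr s).2
    exact ⟨by linarith [this.1], by linarith [this.2]⟩
  · simp only [projIcc_of_mem hr (abs_le.1 hs)]

theorem continuousOn_wavg {m : ℕ} {f : ℝ → ℝ} {δ : ℝ} (hf : ContinuousOn f (Ioo (-δ) δ)) :
    ContinuousOn (wavg m f) (Ioo (-δ) δ) := by
  intro τ hτ
  obtain ⟨r, h1, -, g, hg, hgf⟩ := exists_continuous_eq hf hτ
  refine (((continuous_wavg (m := m) hg).continuousAt (x := τ)).congr ?_).continuousWithinAt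
  filter_upwards [continuous_abs.continuousAt.eventually_lt_const h1] with s hs
  exact wavg_congr hgf hs.le

/-- Differentiation under the integral sign: each derivative brings out a factor σ², raising the
weight by two. -/
theorem hasDerivAt_wavg {m : ℕ} {f f' : ℝ → ℝ} {δ τ : ℝ}
    (hf : ∀ s ∈ Ioo (-δ) δ, HasDerivAt f (f' s) s) (hf' : ContinuousOn f' (Ioo (-δ) δ))
    (hτ : τ ∈ Ioo (-δ) δ) : HasDerivAt (wavg m f) (wavg (m + 2) f' τ) τ := by
  have hfc : ContinuousOn f (Ioo (-δ) δ) := fun s hs => (hf s hs).continuousAt.continuousWithinAt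
  obtain ⟨r, h1, hrδ, g, hg, hgf⟩ := exists_continuous_eq hf' hτ
  have hsub : ∀ s, |s| ≤ r → s ∈ Ioo (-δ) δ := fun s hs => abs_lt.1 (hs.trans_lt hrδ)
  obtain ⟨C, hC⟩ := (isCompact_Icc (a := -r) (b := r)).exists_bound_of_continuousOn
    hg.continuousOn
  have hball : Metric.ball τ (r - |τ|) ∈ nhds τ := Metric.ball_mem_nhds _ (by linarith)
  have hmem : ∀ s ∈ Metric.ball τ (r - |τ|), |s| ≤ r := by
    intro s hs
    rw [Metric.mem_ball, Real.dist_eq] at hs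
    have := abs_sub_abs_le_abs_sub s τ
    linarith
  have hcont : ∀ s, |s| ≤ r → ContinuousOn (fun σ : ℝ => f (s * σ ^ 2) * σ ^ m) (Icc 0 1) := by
    intro s hs
    refine ContinuousOn.mul (hfc.comp (by fun_prop) fun σ hσ => ?_) (by fun_prop)
    exact hsub _ ((abs_mul_sq_le hσ).trans hs)
  have huIoc : uIoc (0 : ℝ) 1 = Ioc 0 1 := uIoc_of_le zero_le_one
  have key := intervalIntegral.hasDerivAt_integral_of_dominated_loc_of_deriv_le
    (μ := MeasureTheory.volume) (a := 0) (b := 1) (x₀ := τ)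
    (F := fun s σ => f (s * σ ^ 2) * σ ^ m) (F' := fun s σ => g (s * σ ^ 2) * σ ^ (m + 2))
    (bound := fun _ => C) hball ?_ ?_ ?_ ?_ ?_ ?_
  · have h2 : wavg (m + 2) f' τ = ∫ σ in (0 : ℝ)..1, g (τ * σ ^ 2) * σ ^ (m + 2) :=
      wavg_congr (fun s hs => (hgf s hs).symm) h1.le
    rw [h2]
    exact key.2
  · filter_upwards [hball] with s hs
    rw [huIoc]
    exact ((hcont s (hmem s hs)).mono Ioc_subset_Icc_self).aestronglyMeasurable measurableSet_Ioc
  · refine ContinuousOn.intervalIntegrable ?_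
    rw [uIcc_of_le zero_le_one]
    exact hcont τ h1.le
  · exact (by fun_prop : Continuous fun σ : ℝ => g (τ * σ ^ 2) * σ ^ (m + 2)).aestronglyMeasurable
  · refine Filter.Eventually.of_forall fun σ hσ s hs => ?_
    rw [huIoc] at hσ
    have h0 : σ ∈ Icc (0 : ℝ) 1 := Ioc_subset_Icc_self hσ
    have h3 := hC _ (abs_le.1 ((abs_mul_sq_le (τ := s) h0).trans (hmem s hs)))
    rw [norm_mul, norm_pow, Real.norm_of_nonneg h0.1]
    exact (mul_le_of_le_one_right (norm_nonneg _) (pow_le_one₀ h0.1 h0.2)).trans h3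
  · exact intervalIntegrable_const
  · refine Filter.Eventually.of_forall fun σ hσ s hs => ?_
    rw [huIoc] at hσ
    have h0 : σ ∈ Icc (0 : ℝ) 1 := Ioc_subset_Icc_self hσ
    have h3 : |s * σ ^ 2| ≤ r := (abs_mul_sq_le h0).trans (hmem s hs)
    have h4 := ((hf _ (hsub _ h3)).comp s ((hasDerivAt_id s).mul_const (σ ^ 2))).mul_const (σ ^ m)
    simp only [hgf _ h3]
    refine h4.congr_deriv ?_
    ring

theorem contDiffOn_wavg {δ : ℝ} (j : ℕ) : ∀ {m : ℕ} {f : ℝ → ℝ},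
    ContDiffOn ℝ j f (Ioo (-δ) δ) → ContDiffOn ℝ j (wavg m f) (Ioo (-δ) δ) := by
  induction j with
  | zero =>
    intro m f hf
    simp only [Nat.cast_zero, contDiffOn_zero] at hf ⊢
    exact continuousOn_wavg hf
  | succ j ih =>
    intro m f hf
    have h := (contDiffOn_succ_iff_deriv_of_isOpen (n := j) isOpen_Ioo).1 (by exact_mod_cast hf)
    have hd : ∀ τ ∈ Ioo (-δ) δ, HasDerivAt (wavg m f) (wavg (m + 2) (deriv f) τ) τ :=
      fun τ hτ => hasDerivAt_wavg
        (fun s hs => (h.1.differentiableAt (isOpen_Ioo.mem_nhds hs)).hasDerivAt)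
        h.2.2.continuousOn hτ
    have := (contDiffOn_succ_iff_deriv_of_isOpen (n := j) (f := wavg m f)
      (isOpen_Ioo (a := -δ) (b := δ))).2
      ⟨fun τ hτ => (hd τ hτ).differentiableAt.differentiableWithinAt, by simp,
        (ih h.2.2).congr fun τ hτ => (hd τ hτ).deriv⟩
    exact_mod_cast this

theorem wavg_neg (m : ℕ) (f : ℝ → ℝ) (τ : ℝ) : wavg m f (-τ) = wavg m (fun s => f (-s)) τ := by
  simp [wavg]

theorem pow_mul_wavg_sq (m : ℕ) (f : ℝ → ℝ) (r : ℝ) :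
    r ^ (m + 1) * wavg m f (r ^ 2) = ∫ s in (0 : ℝ)..r, f (s ^ 2) * s ^ m := by
  have h := intervalIntegral.mul_integral_comp_mul_left (a := 0) (b := 1)
    (f := fun s => f (s ^ 2) * s ^ m) r
  simp only [mul_zero, mul_one] at h
  rw [← h, pow_succ', mul_assoc, wavg, ← intervalIntegral.integral_const_mul]
  congr 2
  ext σ
  rw [mul_pow, mul_pow]
  ring

/-- With τ = r² the average is r^{-(m+1)} ∫₀^r f(s²) s^m ds. In this form it is differentiable for
merely continuous f. -/
theorem hasDerivAt_wavg_of_pos {m : ℕ} {f : ℝ → ℝ} (hf : Continuous f) {τ : ℝ} (hτ : 0 < τ) :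
    HasDerivAt (wavg m f) ((f τ - (m + 1) * wavg m f τ) / (2 * τ)) τ := by
  set r := Real.sqrt τ with hr
  have hrpos : 0 < r := Real.sqrt_pos.2 hτ
  have hr2 : r ^ 2 = τ := Real.sq_sqrt hτ.le
  have hint : HasDerivAt (fun x => ∫ s in (0 : ℝ)..x, f (s ^ 2) * s ^ m) (f (r ^ 2) * r ^ m) r :=
    (by fun_prop : Continuous fun s => f (s ^ 2) * s ^ m).integral_hasStrictDerivAt 0 r
      |>.hasDerivAt
  have hq := hint.div (hasDerivAt_pow (m + 1) r) (pow_ne_zero _ hrpos.ne')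
  have hs := hq.comp τ (Real.hasDerivAt_sqrt hτ.ne')
  have hev : wavg m f =ᶠ[nhds τ]
      ((fun x => (∫ s in (0 : ℝ)..x, f (s ^ 2) * s ^ m) / x ^ (m + 1)) ∘ Real.sqrt) := by
    filter_upwards [lt_mem_nhds hτ] with s hs
    have h1 : 0 < Real.sqrt s := Real.sqrt_pos.2 hs
    have h2 := pow_mul_wavg_sq m f (Real.sqrt s)
    rw [Real.sq_sqrt hs.le] at h2
    simp only [Function.comp_apply, ← h2]
    field_simp
  refine (hs.congr_of_eventuallyEq hev).congr_deriv ?_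
  have h2 := pow_mul_wavg_sq m f r
  rw [hr2] at h2
  rw [← h2, ← hr, ← hr2]
  push_cast
  have hrm : r ^ m ≠ 0 := pow_ne_zero _ hrpos.ne'
  rw [pow_succ r m]
  field_simp

/-- The factor s absorbs the 1/(2τ) in the derivative of the average, so the formula persists
through τ = 0 with no differentiability of f. Hence Y = y + τ `wavg m f` solves 2τY' + (m−1)(Y−y) =
τf. Negative τ reduce to positive ones by reflection. -/
theorem hasDerivAt_mul_wavg {m : ℕ} {f : ℝ → ℝ} {δ τ : ℝ} (hf : ContinuousOn f (Ioo (-δ) δ))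
    (hτ : τ ∈ Ioo (-δ) δ) :
    HasDerivAt (fun s => s * wavg m f s)
      (wavg m f τ + (f τ - (m + 1) * wavg m f τ) / 2) τ := by
  obtain ⟨r, h1, -, g, hg, hgf⟩ := exists_continuous_eq hf hτ
  have hev : (fun s => s * wavg m f s) =ᶠ[nhds τ] fun s => s * wavg m g s := by
    filter_upwards [continuous_abs.continuousAt.eventually_lt_const h1] with s hs
    rw [wavg_congr (fun s hs => (hgf s hs).symm) hs.le]
  rw [wavg_congr (fun s hs => (hgf s hs).symm) h1.le, ← hgf τ h1.le]
  refine HasDerivAt.congr_of_eventuallyEq ?_ hev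
  rcases lt_trichotomy τ 0 with h | h | h
  · have h2 := hasDerivAt_wavg_of_pos (m := m) (f := fun s => g (-s)) (by fun_prop)
      (neg_pos.2 h)
    have h3 := h2.comp τ (hasDerivAt_neg τ)
    have h4 : (wavg m fun s => g (-s)) ∘ Neg.neg = wavg m g := by
      ext s
      simp [← wavg_neg]
    rw [h4, ← wavg_neg, neg_neg] at h3
    refine ((hasDerivAt_id τ).mul h3).congr_deriv ?_
    have := h.ne
    simp only [id_eq]
    field_simp
  · subst h
    have h0 : wavg m g 0 = g 0 / (m + 1) := by
      simp [wavg, integral_pow]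
      ring
    have h5 : HasDerivAt (fun s => s * wavg m g s) (wavg m g 0) 0 := by
      rw [hasDerivAt_iff_tendsto_slope_zero]
      have := ((continuous_wavg (m := m) hg).tendsto 0).mono_left
        (nhdsWithin_le_nhds (s := {0}ᶜ))
      refine this.congr' ?_
      filter_upwards [self_mem_nhdsWithin] with s hs
      have hs' : s ≠ 0 := hs
      simp
      field_simp
    refine h5.congr_deriv ?_
    rw [h0]
    field_simp
    ring
  · refine ((hasDerivAt_id τ).mul (hasDerivAt_wavg_of_pos hg h)).congr_deriv ?_
    have := h.ne'
    simp only [id_eq]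
    field_simp

end KYamabe

/-! ## A singular initial value problem -/

namespace KYamabe

open Set
open scoped ContDiff NNReal

theorem abs_wavg_le {m : ℕ} {f : ℝ → ℝ} {τ C : ℝ} (hf : ∀ s, |s| ≤ |τ| → |f s| ≤ C) :
    |wavg m f τ| ≤ C := by
  have h := intervalIntegral.norm_integral_le_of_norm_le_const (a := 0) (b := 1) (C := C)
    (f := fun σ : ℝ => f (τ * σ ^ 2) * σ ^ m) fun σ hσ => by
      rw [uIoc_of_le zero_le_one] at hσ
      have h0 : σ ∈ Icc (0 : ℝ) 1 := Ioc_subset_Icc_self hσ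
      rw [norm_mul, norm_pow, Real.norm_of_nonneg h0.1]
      exact (mul_le_of_le_one_right (norm_nonneg _) (pow_le_one₀ h0.1 h0.2)).trans
        (hf _ (abs_mul_sq_le h0))
  simpa [wavg] using h

theorem wavg_sub {m : ℕ} {f g : ℝ → ℝ} (hf : Continuous f) (hg : Continuous g) (τ : ℝ) :
    wavg m f τ - wavg m g τ = wavg m (fun s => f s - g s) τ := by
  unfold wavg
  rw [← intervalIntegral.integral_sub (Continuous.intervalIntegrable (by fun_prop) _ _)
    (Continuous.intervalIntegrable (by fun_prop) _ _)]
  simp only [sub_mul]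

/-- Averaging does not increase the sup norm and the prefactor is at most δ, so the integral map is
Lipschitz with constant δK ≤ 1/2 and has a fixed point. -/
theorem exists_fixed_point_wavg {G₁ G₂ : ℝ × (ℝ × ℝ) → ℝ} {K : ℝ≥0} (h₁ : LipschitzWith K G₁)
    (h₂ : LipschitzWith K G₂) (x : ℝ × ℝ) (m₁ m₂ : ℕ) :
    ∃ δ > 0, ∃ X : ℝ → ℝ × ℝ, Continuous X ∧ ∀ τ, |τ| ≤ δ →
      X τ = (x.1 + τ * wavg m₁ (fun s => G₁ (s, X s)) τ,
        x.2 + τ * wavg m₂ (fun s => G₂ (s, X s)) τ) := by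
  have hG₁ := h₁.continuous
  have hG₂ := h₂.continuous
  set δ : ℝ := 1 / (2 * ((K : ℝ) + 1)) with hδ
  have hK : (0 : ℝ) ≤ K := K.2
  have hδpos : 0 < δ := by positivity
  have hδK : δ * K ≤ 1 / 2 := by
    rw [hδ, div_mul_eq_mul_div, div_le_iff₀ (by positivity)]; linarith
  have hle : -δ ≤ δ := by linarith
  let ext : C(Icc (-δ) δ, ℝ × ℝ) → ℝ → ℝ × ℝ := fun X s => X (projIcc (-δ) δ hle s)
  have hext : ∀ X, Continuous (ext X) := fun X => X.continuous.comp continuous_projIcc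
  have hcG₁ : ∀ X, Continuous fun s => G₁ (s, ext X s) := fun X => by
    have := hext X; fun_prop
  have hcG₂ : ∀ X, Continuous fun s => G₂ (s, ext X s) := fun X => by
    have := hext X; fun_prop
  let Ψ : C(Icc (-δ) δ, ℝ × ℝ) → C(Icc (-δ) δ, ℝ × ℝ) := fun X =>
    ⟨fun τ => (x.1 + τ * wavg m₁ (fun s => G₁ (s, ext X s)) τ,
        x.2 + τ * wavg m₂ (fun s => G₂ (s, ext X s)) τ), by
      have e₁ := continuous_wavg (m := m₁) (hcG₁ X)
      have e₂ := continuous_wavg (m := m₂) (hcG₂ X)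
      fun_prop⟩
  have hdiff : ∀ {G : ℝ × (ℝ × ℝ) → ℝ}, LipschitzWith K G → ∀ (m : ℕ) (y : ℝ)
      (X Y : C(Icc (-δ) δ, ℝ × ℝ)) (τ : Icc (-δ) δ),
      |(y + τ * wavg m (fun s => G (s, ext X s)) τ)
        - (y + τ * wavg m (fun s => G (s, ext Y s)) τ)| ≤ 1 / 2 * dist X Y := by
    intro G hG m y X Y τ
    have hGc := hG.continuous
    have hcX : Continuous fun s => G (s, ext X s) := by have := hext X; fun_prop
    have hcY : Continuous fun s => G (s, ext Y s) := by have := hext Y; fun_prop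
    have h3 : |wavg m (fun s => G (s, ext X s)) τ - wavg m (fun s => G (s, ext Y s)) τ|
        ≤ K * dist X Y := by
      rw [wavg_sub hcX hcY]
      refine abs_wavg_le fun s _ => ?_
      refine (hG.dist_le_mul _ _).trans ?_
      gcongr
      rw [dist_prod_same_left]
      exact ContinuousMap.dist_apply_le_dist _
    have h4 : |(τ : ℝ)| ≤ δ := abs_le.2 τ.2
    calc _ = |(τ : ℝ)| * |wavg m (fun s => G (s, ext X s)) τ
            - wavg m (fun s => G (s, ext Y s)) τ| := by rw [← abs_mul]; congr 1; ring
      _ ≤ δ * (K * dist X Y) := by gcongr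
      _ = δ * K * dist X Y := by ring
      _ ≤ 1 / 2 * dist X Y := by gcongr
  have hΨ : ContractingWith (1 / 2) Ψ := by
    refine ⟨by norm_num, LipschitzWith.of_dist_le_mul fun X Y => ?_⟩
    have hhalf : (((1 / 2 : ℝ≥0)) : ℝ) = 1 / 2 := by norm_num
    rw [hhalf, ContinuousMap.dist_le (by positivity)]
    intro τ
    rw [Prod.dist_eq]
    exact max_le (hdiff h₁ m₁ x.1 X Y τ) (hdiff h₂ m₂ x.2 X Y τ)
  obtain ⟨Z, hfix⟩ : ∃ Z, Ψ Z = Z := ⟨_, hΨ.fixedPoint_isFixedPt⟩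
  refine ⟨δ, hδpos, ext Z, hext _, fun τ hτ => ?_⟩
  have h5 : ext Z τ = Z ⟨τ, abs_le.1 hτ⟩ := by
    simp only [ext, projIcc_of_mem hle (abs_le.1 hτ)]
  rw [h5]
  conv_lhs => rw [← hfix]
  rfl

/-- Local solvability, with smooth solutions, of the singular initial value problem
`2 τ Xᵢ' + (mᵢ - 1) (Xᵢ - xᵢ) = τ Fᵢ(τ, X)`, `X(0) = x`. -/
theorem exists_contDiffOn_singular_ode {F₁ F₂ : ℝ × (ℝ × ℝ) → ℝ} {U : Set (ℝ × (ℝ × ℝ))}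
    (hU : IsOpen U) (hF₁ : ContDiffOn ℝ ∞ F₁ U) (hF₂ : ContDiffOn ℝ ∞ F₂ U) {x : ℝ × ℝ}
    (hx : (0, x) ∈ U) (m₁ m₂ : ℕ) :
    ∃ δ > 0, ∃ X₁ X₂ : ℝ → ℝ, X₁ 0 = x.1 ∧ X₂ 0 = x.2 ∧
      (∀ τ ∈ Ioo (-δ) δ, (τ, (X₁ τ, X₂ τ)) ∈ U) ∧
      ContDiffOn ℝ ∞ X₁ (Ioo (-δ) δ) ∧ ContDiffOn ℝ ∞ X₂ (Ioo (-δ) δ) ∧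
      (∀ τ ∈ Ioo (-δ) δ,
        2 * τ * deriv X₁ τ + ((m₁ : ℝ) - 1) * (X₁ τ - x.1) = τ * F₁ (τ, (X₁ τ, X₂ τ))) ∧
      ∀ τ ∈ Ioo (-δ) δ,
        2 * τ * deriv X₂ τ + ((m₂ : ℝ) - 1) * (X₂ τ - x.2) = τ * F₂ (τ, (X₁ τ, X₂ τ)) := by
  have hUx := hU.mem_nhds hx
  obtain ⟨K₁, t₁, ht₁, hL₁⟩ := ((hF₁.contDiffAt hUx).of_le (m := 1)
    (by simp)).exists_lipschitzOnWith
  obtain ⟨K₂, t₂, ht₂, hL₂⟩ := ((hF₂.contDiffAt hUx).of_le (m := 1)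
    (by simp)).exists_lipschitzOnWith
  -- The fields are replaced by globally Lipschitz extensions; for small τ the fixed point stays
  -- where they agree with the original ones.
  obtain ⟨G₁, hG₁, hFG₁⟩ := hL₁.extend_real
  obtain ⟨G₂, hG₂, hFG₂⟩ := hL₂.extend_real
  obtain ⟨δ₀, hδ₀, X, hX, hfix⟩ := exists_fixed_point_wavg (hG₁.weaken (le_max_left K₁ K₂))
    (hG₂.weaken (le_max_right K₁ K₂)) x m₁ m₂
  have hX0 : X 0 = x := by rw [hfix 0 (by simpa using hδ₀.le)]; simp
  have hcont : Continuous fun τ : ℝ => (τ, X τ) := by fun_prop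
  have hnhds : ∀ᶠ τ in nhds (0 : ℝ), (τ, X τ) ∈ U ∩ (t₁ ∩ t₂) := by
    refine hcont.continuousAt.eventually ?_
    simp only [hX0]
    exact Filter.inter_mem hUx (Filter.inter_mem ht₁ ht₂)
  obtain ⟨ε, hε, hball⟩ := Metric.eventually_nhds_iff.1 hnhds
  set δ := min δ₀ ε with hδ
  have hmem : ∀ τ, |τ| < δ → (τ, X τ) ∈ U ∩ (t₁ ∩ t₂) := fun τ hτ =>
    hball (by rw [Real.dist_eq, sub_zero]; exact hτ.trans_le (min_le_right _ _))
  have hI : ∀ τ ∈ Ioo (-δ) δ, |τ| < δ := fun τ hτ => abs_lt.2 hτ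
  have hfix₁ : ∀ τ ∈ Ioo (-δ) δ, (X τ).1 = x.1 + τ * wavg m₁ (fun s => F₁ (s, X s)) τ := by
    intro τ hτ
    rw [hfix τ ((hI τ hτ).le.trans (min_le_left _ _))]
    simp only
    rw [wavg_congr (fun s hs => (hFG₁ (hmem s (hs.trans_lt (hI τ hτ))).2.1).symm) le_rfl]
  have hfix₂ : ∀ τ ∈ Ioo (-δ) δ, (X τ).2 = x.2 + τ * wavg m₂ (fun s => F₂ (s, X s)) τ := by
    intro τ hτ
    rw [hfix τ ((hI τ hτ).le.trans (min_le_left _ _))]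
    simp only
    rw [wavg_congr (fun s hs => (hFG₂ (hmem s (hs.trans_lt (hI τ hτ))).2.2).symm) le_rfl]
  have hcomp : ∀ {F : ℝ × (ℝ × ℝ) → ℝ}, ContDiffOn ℝ ∞ F U → ∀ j : ℕ,
      ContDiffOn ℝ j X (Ioo (-δ) δ) → ContDiffOn ℝ j (fun s => F (s, X s)) (Ioo (-δ) δ) := by
    intro F hF j hXj
    exact (hF.of_le (by exact_mod_cast le_top)).comp (contDiffOn_id.prodMk hXj)
      fun τ hτ => (hmem τ (hI τ hτ)).1
  have hderiv : ∀ {F : ℝ × (ℝ × ℝ) → ℝ}, ContDiffOn ℝ ∞ F U → ∀ {Y : ℝ → ℝ} {y : ℝ} {m : ℕ},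
      (∀ τ ∈ Ioo (-δ) δ, Y τ = y + τ * wavg m (fun s => F (s, X s)) τ) → ∀ τ ∈ Ioo (-δ) δ,
      HasDerivAt Y (wavg m (fun s => F (s, X s)) τ
        + (F (τ, X τ) - (m + 1) * wavg m (fun s => F (s, X s)) τ) / 2) τ := by
    intro F hF Y y m hY τ hτ
    have hc := hcomp hF 0 (by simpa using hX.continuousOn)
    rw [Nat.cast_zero, contDiffOn_zero] at hc
    refine ((hasDerivAt_mul_wavg (m := m) hc hτ).const_add y).congr_of_eventuallyEq ?_
    filter_upwards [isOpen_Ioo.mem_nhds hτ] with s hs using hY s hs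
  -- Bootstrap: averages preserve C^j, and Y' is a combination of F(s, X) and its average, so X of
  -- class C^j makes X' of class C^j.
  have hsmooth : ∀ j : ℕ, ContDiffOn ℝ j X (Ioo (-δ) δ) := by
    intro j
    induction j with
    | zero => simpa using hX.continuousOn
    | succ j ih =>
      have step : ∀ {F : ℝ × (ℝ × ℝ) → ℝ}, ContDiffOn ℝ ∞ F U → ∀ {Y : ℝ → ℝ} {y : ℝ} {m : ℕ},
          (∀ τ ∈ Ioo (-δ) δ, Y τ = y + τ * wavg m (fun s => F (s, X s)) τ) →
          ContDiffOn ℝ ((j + 1 : ℕ) : WithTop ℕ∞) Y (Ioo (-δ) δ) := by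
        intro F hF Y y m hY
        have hd := hderiv hF hY
        have hw := contDiffOn_wavg j (m := m) (hcomp hF j ih)
        have := (contDiffOn_succ_iff_deriv_of_isOpen (n := j) (f := Y)
          (isOpen_Ioo (a := -δ) (b := δ))).2
          ⟨fun τ hτ => (hd τ hτ).differentiableAt.differentiableWithinAt, by simp,
            (hw.add (((hcomp hF j ih).sub (contDiffOn_const.mul hw)).div_const 2)).congr
              fun τ hτ => (hd τ hτ).deriv⟩
        exact_mod_cast this
      exact (step hF₁ hfix₁).prodMk (step hF₂ hfix₂)
  have hinf : ContDiffOn ℝ ∞ X (Ioo (-δ) δ) := contDiffOn_infty.2 hsmooth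
  refine ⟨δ, lt_min hδ₀ hε, fun τ => (X τ).1, fun τ => (X τ).2, by simp [hX0], by simp [hX0],
    fun τ hτ => (hmem τ (hI τ hτ)).1, hinf.fst, hinf.snd, fun τ hτ => ?_, fun τ hτ => ?_⟩
  · rw [(hderiv hF₁ hfix₁ τ hτ).deriv]
    change _ = τ * F₁ (τ, X τ)
    linear_combination ((m₁ : ℝ) - 1) * hfix₁ τ hτ
  · rw [(hderiv hF₂ hfix₂ τ hτ).deriv]
    change _ = τ * F₂ (τ, X τ)
    linear_combination ((m₂ : ℝ) - 1) * hfix₂ τ hτ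

end KYamabe

/-! ## Differential inequalities and complete vector fields -/

namespace KYamabe

open Set
open scoped ContDiff NNReal

/-- A function that starts nonnegative and is nondecreasing wherever it is negative stays
nonnegative. -/
theorem nonneg_of_deriv_nonneg_of_neg {φ : ℝ → ℝ} {a b : ℝ} (hφ : ContinuousOn φ (Icc a b))
    (ha : 0 ≤ φ a) (h : ∀ t ∈ Ioo a b, φ t < 0 → ∃ d, 0 ≤ d ∧ HasDerivAt φ d t) :
    ∀ t ∈ Icc a b, 0 ≤ φ t := by
  intro t₁ ht₁
  by_contra! hneg
  have hcont : ContinuousOn φ (Icc a t₁) := hφ.mono (Icc_subset_Icc_right ht₁.2)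
  set A := Icc a t₁ ∩ φ ⁻¹' Ici 0 with hA
  have hclosed : IsClosed A := hcont.preimage_isClosed_of_isClosed isClosed_Icc isClosed_Ici
  have hbdd : BddAbove A := ⟨t₁, fun t ht => ht.1.2⟩
  have hs : sSup A ∈ A := hclosed.csSup_mem ⟨a, ⟨le_rfl, ht₁.1⟩, ha⟩ hbdd
  set s := sSup A with hsdef
  have hmono : MonotoneOn φ (Icc s t₁) := by
    have hd : ∀ t ∈ Ioo s t₁, ∃ d, 0 ≤ d ∧ HasDerivAt φ d t := by
      intro t ht
      refine h t ⟨hs.1.1.trans_lt ht.1, ht.2.trans_le ht₁.2⟩ ?_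
      by_contra! hnn
      exact absurd (le_csSup hbdd (⟨⟨hs.1.1.trans ht.1.le, ht.2.le⟩, hnn⟩ : t ∈ A))
        (not_le.2 ht.1)
    refine monotoneOn_of_deriv_nonneg (convex_Icc s t₁)
      (hcont.mono (Icc_subset_Icc_left hs.1.1)) (fun t ht => ?_) fun t ht => ?_
    · rw [interior_Icc] at ht
      obtain ⟨d, -, hd⟩ := hd t ht
      exact hd.differentiableAt.differentiableWithinAt
    · rw [interior_Icc] at ht
      obtain ⟨d, hd0, hd⟩ := hd t ht
      rw [hd.deriv]
      exact hd0
  have h1 := hmono ⟨le_rfl, hs.1.2⟩ ⟨hs.1.2, le_rfl⟩ hs.1.2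
  have h2 : 0 ≤ φ s := hs.2
  linarith

/-- Where φ < 0 the hypothesis reads φ' ≥ Kφ, so e^{-Kt}φ is nondecreasing there. -/
theorem nonneg_of_neg_mul_abs_le_deriv {φ φ' : ℝ → ℝ} {K t₀ : ℝ}
    (hφ : ∀ t, t₀ ≤ t → HasDerivAt φ (φ' t) t) (h : ∀ t, t₀ ≤ t → -K * |φ t| ≤ φ' t)
    (h0 : 0 ≤ φ t₀) : ∀ t, t₀ ≤ t → 0 ≤ φ t := by
  intro t ht
  have hd : ∀ s, t₀ ≤ s → HasDerivAt (fun s => φ s * Real.exp (-K * s))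
      ((φ' s - K * φ s) * Real.exp (-K * s)) s := fun s hs => by
    have h1 : HasDerivAt (fun s => Real.exp (-K * s)) (Real.exp (-K * s) * (-K * 1)) s :=
      ((hasDerivAt_id s).const_mul (-K)).exp
    refine ((hφ s hs).mul h1).congr_deriv ?_
    ring
  have key := nonneg_of_deriv_nonneg_of_neg (φ := fun s => φ s * Real.exp (-K * s)) (a := t₀)
    (b := t) (fun s hs => (hd s hs.1).continuousAt.continuousWithinAt) (by positivity)
    (fun s hs hneg => ⟨_, ?_, hd s hs.1.le⟩) t ⟨ht, le_rfl⟩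
  · exact nonneg_of_mul_nonneg_left key (Real.exp_pos _)
  · have h2 : φ s < 0 := neg_of_mul_neg_left hneg (Real.exp_pos _).le
    have h3 := h s hs.1.le
    rw [abs_of_neg h2] at h3
    exact mul_nonneg (by linarith) (Real.exp_pos _).le

/-- Once φ ≥ 0 is known, the hypothesis reads φ' ≥ −Kφ, so e^{Kt}φ is nondecreasing. -/
theorem pos_of_neg_mul_abs_le_deriv {φ φ' : ℝ → ℝ} {K t₀ : ℝ}
    (hφ : ∀ t, t₀ ≤ t → HasDerivAt φ (φ' t) t) (h : ∀ t, t₀ ≤ t → -K * |φ t| ≤ φ' t)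
    (h0 : 0 < φ t₀) : ∀ t, t₀ ≤ t → 0 < φ t := by
  intro t ht
  have hnn := nonneg_of_neg_mul_abs_le_deriv hφ h h0.le
  have hd : ∀ s, t₀ ≤ s → HasDerivAt (fun s => φ s * Real.exp (K * s))
      ((φ' s + K * φ s) * Real.exp (K * s)) s := fun s hs => by
    have h1 : HasDerivAt (fun s => Real.exp (K * s)) (Real.exp (K * s) * (K * 1)) s :=
      ((hasDerivAt_id s).const_mul K).exp
    refine ((hφ s hs).mul h1).congr_deriv ?_
    ring
  have hmono : MonotoneOn (fun s => φ s * Real.exp (K * s)) (Ici t₀) := by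
    refine monotoneOn_of_deriv_nonneg (convex_Ici t₀)
      (fun s hs => (hd s hs).continuousAt.continuousWithinAt)
      (fun s hs => ?_) fun s hs => ?_ <;> rw [interior_Ici, mem_Ioi] at hs
    · exact (hd s hs.le).differentiableAt.differentiableWithinAt
    · rw [(hd s hs.le).deriv]
      have h3 := h s hs.le
      rw [abs_of_nonneg (hnn s hs.le)] at h3
      exact mul_nonneg (by linarith) (Real.exp_pos _).le
  have h4 := hmono (mem_Ici.2 le_rfl) (mem_Ici.2 ht) ht
  have h5 : 0 < φ t₀ * Real.exp (K * t₀) := by positivity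
  exact pos_of_mul_pos_left (h5.trans_le h4) (Real.exp_pos _).le

section VectorField

variable {B : Type*} [NormedAddCommGroup B] [NormedSpace ℝ B]

/-- Bounded Lipschitz autonomous vector fields are complete. -/
theorem exists_hasDerivAt_of_bounded_lipschitz [CompleteSpace B] {V : B → B} {K L : ℝ≥0}
    (hV : LipschitzWith K V) (hL : ∀ x, ‖V x‖ ≤ L) (t₀ : ℝ) (x₀ : B) :
    ∃ γ : ℝ → B, γ t₀ = x₀ ∧ ∀ t, HasDerivAt γ (V (γ t)) t := by
  -- With speed at most L, a solution moves at most L(N+1) in time N+1, so Picard–Lindelöf applies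
  -- on each such interval. Uniqueness then glues the pieces.
  have hex : ∀ N : ℕ, ∃ α : ℝ → B, α t₀ = x₀ ∧
      ∀ t ∈ Ioo (t₀ - (N + 1)) (t₀ + (N + 1)), HasDerivAt α (V (α t)) t := by
    intro N
    have hmem : t₀ ∈ Icc (t₀ - ((N : ℝ) + 1)) (t₀ + (N + 1)) := by
      constructor <;> linarith [(Nat.cast_nonneg N : (0 : ℝ) ≤ N)]
    have hpl : IsPicardLindelof (fun _ => V) (⟨t₀, hmem⟩ : Icc (t₀ - ((N : ℝ) + 1)) (t₀ + (N + 1)))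
        x₀ (L * (N + 1)) 0 L K := by
      refine IsPicardLindelof.of_time_independent (fun x _ => hL x) hV.lipschitzOnWith ?_
      simp
    obtain ⟨α, h0, hα⟩ := hpl.exists_eq_forall_mem_Icc_hasDerivWithinAt₀
    exact ⟨α, h0, fun t ht => (hα t (Ioo_subset_Icc_self ht)).hasDerivAt (Icc_mem_nhds ht.1 ht.2)⟩
  choose α h0 hα using hex
  have hagree : ∀ {M N : ℕ}, M ≤ N → ∀ t, |t - t₀| < M + 1 → α M t = α N t := by
    intro M N hMN t ht
    have hMN' : (M : ℝ) ≤ N := by exact_mod_cast hMN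
    have hM : (0 : ℝ) ≤ M := Nat.cast_nonneg M
    rw [abs_lt] at ht
    refine ODE_solution_unique_of_mem_Ioo (v := fun _ => V) (s := fun _ => univ) (K := K)
      (fun _ _ => hV.lipschitzOnWith) (t₀ := t₀) (a := t₀ - (M + 1)) (b := t₀ + (M + 1))
      ⟨by linarith, by linarith⟩ (fun s hs => ⟨hα M s hs, trivial⟩)
      (fun s hs => ⟨hα N s ⟨by linarith [hs.1], by linarith [hs.2]⟩, trivial⟩)
      ((h0 M).trans (h0 N).symm) ⟨by linarith, by linarith⟩
  have hα' : ∀ N : ℕ, ∀ t, |t - t₀| < N + 1 → α ⌈|t - t₀|⌉₊ t = α N t := by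
    intro N t ht
    rcases le_total ⌈|t - t₀|⌉₊ N with h | h
    · exact hagree h t (by linarith [Nat.le_ceil |t - t₀|])
    · exact (hagree h t ht).symm
  refine ⟨fun t => α ⌈|t - t₀|⌉₊ t, h0 _, fun t => ?_⟩
  set N := ⌈|t - t₀|⌉₊
  have hN : |t - t₀| < N + 1 := by linarith [Nat.le_ceil |t - t₀|]
  have hev : (fun s => α ⌈|s - t₀|⌉₊ s) =ᶠ[nhds t] α N := by
    have hc : Continuous fun s : ℝ => |s - t₀| := by fun_prop
    filter_upwards [hc.continuousAt.eventually_lt_const hN] with s hs using hα' N s hs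
  refine HasDerivAt.congr_of_eventuallyEq ?_ hev
  rw [abs_lt] at hN
  exact hα N t ⟨by linarith, by linarith⟩

theorem contDiffOn_of_hasDerivAt {V : B → B} {U : Set B} (hV : ContDiffOn ℝ ∞ V U)
    {γ : ℝ → B} {I : Set ℝ} (hI : IsOpen I) (hγ : ∀ t ∈ I, HasDerivAt γ (V (γ t)) t)
    (hU : ∀ t ∈ I, γ t ∈ U) : ContDiffOn ℝ ∞ γ I := by
  refine contDiffOn_infty.2 fun j => ?_
  induction j with
  | zero =>
    rw [Nat.cast_zero, contDiffOn_zero]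
    exact fun t ht => (hγ t ht).continuousAt.continuousWithinAt
  | succ j ih =>
    have := (contDiffOn_succ_iff_deriv_of_isOpen (n := j) (f := γ) hI).2
      ⟨fun t ht => (hγ t ht).differentiableAt.differentiableWithinAt, by simp,
        ((hV.of_le (by exact_mod_cast le_top)).comp ih hU).congr fun t ht => (hγ t ht).deriv⟩
    exact_mod_cast this

end VectorField

end KYamabe

/-! ## The soliton profile near the origin -/

namespace KYamabe

open Set
open scoped ContDiff NNReal

/-- With `p = d log v / d log r` and `η` the defect of the equation from being conformally round,
the autonomous system in `log r` has the components `profileField₁`, `profileField₂`. -/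
noncomputable def profileField₁ (n k : ℕ) (y : ℝ × ℝ) : ℝ :=
  y.1 * (1 - y.1 / 2) * (2 - n / k * y.2)

/-- See `profileField₁`. -/
noncomputable def profileField₂ (n k : ℕ) (g : ℝ → ℝ) (y : ℝ × ℝ) : ℝ :=
  (1 - y.2) * (y.1 * g y.1 * (2 * k - n * y.2) - n * (1 - y.1) * y.2)

/-- The system is singular at τ = 0, so it is desingularized by p = τP and η = τ(γP + Z). Solving on
both sides of τ = 0 makes the profile smooth in |x|² at the origin. -/
theorem exists_local_profile {n k : ℕ} (hk : 0 < k) (hnk : n < 2 * k) {g₀ : ℝ} {g₁ : ℝ → ℝ}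
    {W : Set ℝ} (hW : IsOpen W) (hW0 : (0 : ℝ) ∈ W) (hg₁ : ContDiffOn ℝ ∞ g₁ W)
    (hg : ∀ p ∈ Icc (0 : ℝ) 2, 0 ≤ g₀ + p * g₁ p) {κ : ℝ} (hκ : 0 < κ) :
    ∃ δ > 0, ∃ P η : ℝ → ℝ, P 0 = κ ∧ η 0 = 0 ∧
      ContDiffOn ℝ ∞ P (Ioo (-δ) δ) ∧ ContDiffOn ℝ ∞ η (Ioo (-δ) δ) ∧
      ∀ τ ∈ Ioo 0 δ, 0 < τ * P τ ∧ τ * P τ < 2 ∧ 0 ≤ η τ ∧ η τ < 1 ∧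
        HasDerivAt (fun s => s * P s) (profileField₁ n k (τ * P τ, η τ) / (2 * τ)) τ ∧
        HasDerivAt η (profileField₂ n k (fun p => g₀ + p * g₁ p) (τ * P τ, η τ) / (2 * τ)) τ := by
  have hk' : (0 : ℝ) < k := by exact_mod_cast hk
  have hnk' : (n : ℝ) < 2 * k := by exact_mod_cast hnk
  have hn' : (0 : ℝ) ≤ n := Nat.cast_nonneg n
  -- To first order in τ the η-equation gives (n+2)η = 2k g₀ p. Subtracting γp leaves a Z with Z(0)
  -- = 0 and makes the remaining terms divisible by τ.
  set γ : ℝ := 2 * k * g₀ / (n + 2) with hγ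
  have hγ' : (n + 2) * γ = 2 * k * g₀ := by rw [hγ]; field_simp
  clear_value γ
  set U : Set (ℝ × (ℝ × ℝ)) := {z | z.1 * z.2.1 ∈ W} with hUdef
  have hU : IsOpen U := hW.preimage (by fun_prop)
  set F₁ : ℝ × (ℝ × ℝ) → ℝ := fun z => z.2.1 * (-z.2.1 - n / k * (γ * z.2.1 + z.2.2)
    + z.1 * (n / (2 * k)) * z.2.1 * (γ * z.2.1 + z.2.2)) with hF₁
  obtain ⟨G, hG⟩ : ∃ G : ℝ × (ℝ × ℝ) → ℝ, ∀ z, G z = g₁ (z.1 * z.2.1) := ⟨_, fun _ => rfl⟩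
  set F₂ : ℝ × (ℝ × ℝ) → ℝ := fun z => 2 * k * z.2.1 ^ 2 * G z
    - n * (γ * z.2.1 + z.2.2) * z.2.1 * (g₀ + z.1 * z.2.1 * G z)
    - (γ * z.2.1 + z.2.2) * z.2.1 * (g₀ + z.1 * z.2.1 * G z)
      * (2 * k - n * z.1 * (γ * z.2.1 + z.2.2))
    + n * z.2.1 * (γ * z.2.1 + z.2.2) + n * (γ * z.2.1 + z.2.2) ^ 2 * (1 - z.1 * z.2.1)
    - γ * F₁ z with hF₂
  have hGc : ContDiffOn ℝ ∞ G U :=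
    (hg₁.comp (f := fun z : ℝ × (ℝ × ℝ) => z.1 * z.2.1) (by fun_prop) fun z hz => hz).congr
      fun z _ => hG z
  have hF₁c : ContDiff ℝ ∞ F₁ := by rw [hF₁]; fun_prop
  have hF₂c : ContDiffOn ℝ ∞ F₂ U := by
    have := hF₁c.contDiffOn (s := U)
    rw [hF₂]; fun_prop
  -- The weights 1 and n+3 produce the linear terms 0 · (P − κ) and (n+2)Z.
  obtain ⟨δ₀, hδ₀, P, Z, hP0, hZ0, -, hPc, hZc, hPeq, hZeq⟩ :=
    exists_contDiffOn_singular_ode hU hF₁c.contDiffOn hF₂c (x := (κ, 0))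
      (by simpa [hUdef] using hW0) 1 (n + 3)
  have h0mem : (0 : ℝ) ∈ Ioo (-δ₀) δ₀ := ⟨by linarith, hδ₀⟩
  set η : ℝ → ℝ := fun τ => τ * (γ * P τ + Z τ) with hη
  have hηc : ContDiffOn ℝ ∞ η (Ioo (-δ₀) δ₀) := by rw [hη]; fun_prop
  have hnh : Ioo (-δ₀) δ₀ ∈ nhds (0 : ℝ) := isOpen_Ioo.mem_nhds h0mem
  have hPat : ContinuousAt P 0 := hPc.continuousOn.continuousAt hnh
  have hηat : ContinuousAt η 0 := hηc.continuousOn.continuousAt hnh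
  have hη0 : η 0 = 0 := by simp [hη]
  have hev : ∀ᶠ τ in nhds (0 : ℝ), 0 < P τ ∧ τ * P τ < 1 ∧ η τ < 1 := by
    refine (hPat.eventually_const_lt (by rw [hP0]; exact hκ)).and
      (((continuousAt_id.mul hPat).eventually_lt_const (by simp)).and
        (hηat.eventually_lt_const (by rw [hη0]; exact one_pos)))
  obtain ⟨ε, hε, hball⟩ := Metric.eventually_nhds_iff.1 hev
  have hsmall : ∀ τ ∈ Ioo 0 (min δ₀ ε), 0 < P τ ∧ τ * P τ < 1 ∧ η τ < 1 := fun τ hτ =>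
    hball (by
      rw [Real.dist_eq, sub_zero, abs_of_pos hτ.1]
      exact hτ.2.trans_le (min_le_right _ _))
  have hsub : Ioo (-min δ₀ ε) (min δ₀ ε) ⊆ Ioo (-δ₀) δ₀ :=
    Ioo_subset_Ioo (neg_le_neg (min_le_left _ _)) (min_le_left _ _)
  have hI : ∀ τ ∈ Ioo 0 (min δ₀ ε), τ ∈ Ioo (-δ₀) δ₀ := fun τ hτ =>
    ⟨by linarith [hτ.1], hτ.2.trans_le (min_le_left _ _)⟩
  have hder : ∀ τ ∈ Ioo 0 (min δ₀ ε),
      HasDerivAt (fun s => s * P s) (profileField₁ n k (τ * P τ, η τ) / (2 * τ)) τ ∧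
      HasDerivAt η (profileField₂ n k (fun p => g₀ + p * g₁ p) (τ * P τ, η τ) / (2 * τ)) τ := by
    intro τ hτ
    have hτI := hI τ hτ
    have hτ0 : τ ≠ 0 := hτ.1.ne'
    have hPd := ((hPc.contDiffAt (isOpen_Ioo.mem_nhds hτI)).differentiableAt (by simp)).hasDerivAt
    have hZd := ((hZc.contDiffAt (isOpen_Ioo.mem_nhds hτI)).differentiableAt (by simp)).hasDerivAt
    have h1 := hPeq τ hτI
    have h2 := hZeq τ hτI
    simp only [hF₁, hF₂, hG] at h1 h2
    push_cast at h1 h2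
    constructor
    · refine ((hasDerivAt_id τ).mul hPd).congr_deriv ?_
      rw [eq_div_iff (by positivity)]
      simp only [profileField₁, hη, id_eq]
      linear_combination τ * h1
    · refine ((hasDerivAt_id τ).mul ((hPd.const_mul γ).add hZd)).congr_deriv ?_
      rw [eq_div_iff (by positivity)]
      simp only [profileField₂, hη, id_eq, Pi.add_apply]
      linear_combination τ * h2 + τ * γ * h1 + τ * P τ * hγ'
  refine ⟨min δ₀ ε, lt_min hδ₀ hε, P, η, hP0, hη0, hPc.mono hsub, hηc.mono hsub,
    fun τ hτ => ?_⟩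
  obtain ⟨hPpos, hp1, hη1⟩ := hsmall τ hτ
  refine ⟨mul_pos hτ.1 hPpos, by linarith, ?_, hη1, hder τ hτ⟩
  -- Near the origin p < 1, so wherever η < 0 both terms in the second factor of `profileField₂` are
  -- nonnegative and η cannot decrease.
  refine nonneg_of_deriv_nonneg_of_neg (a := 0) (b := τ)
    (hηc.continuousOn.mono fun s hs => ⟨by linarith [hs.1],
      (hs.2.trans_lt hτ.2).trans_le (min_le_left _ _)⟩) hη0.ge (fun s hs hneg => ?_) τ
    ⟨hτ.1.le, le_rfl⟩
  have hs' : s ∈ Ioo 0 (min δ₀ ε) := ⟨hs.1, hs.2.trans hτ.2⟩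
  obtain ⟨hPs, hps, -⟩ := hsmall s hs'
  refine ⟨_, ?_, (hder s hs').2⟩
  have hsP := mul_pos hs.1 hPs
  have hgs := hg (s * P s) ⟨hsP.le, by linarith⟩
  refine div_nonneg ?_ (by linarith [hs.1])
  simp only [profileField₂]
  refine mul_nonneg (by linarith) ?_
  have h3 : 0 ≤ s * P s * (g₀ + s * P s * g₁ (s * P s)) * (2 * k - n * η s) :=
    mul_nonneg (mul_nonneg hsP.le hgs) (by nlinarith)
  have h4 : 0 ≤ n * (1 - s * P s) * (-η s) :=
    mul_nonneg (mul_nonneg hn' (by linarith)) (by linarith)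
  linarith

end KYamabe

/-! ## The soliton profile on the half line -/

namespace KYamabe

open Set
open scoped ContDiff NNReal

theorem abs_sub_projIcc_le {a b : ℝ} (h : a ≤ b) {z : ℝ} (hz : z ∈ Icc a b) (y : ℝ) :
    |z - projIcc a b h y| ≤ |z - y| := by
  have := (LipschitzWith.projIcc h).dist_le_mul z y
  rw [projIcc_of_mem h hz] at this
  simpa [Subtype.dist_eq, Real.dist_eq] using this

theorem hasDerivAt_fst {Y : ℝ → ℝ × ℝ} {y : ℝ × ℝ} {t : ℝ} (h : HasDerivAt Y y t) :
    HasDerivAt (fun t => (Y t).1) y.1 t :=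
  (ContinuousLinearMap.fst ℝ ℝ ℝ).hasFDerivAt.comp_hasDerivAt t h

theorem hasDerivAt_snd {Y : ℝ → ℝ × ℝ} {y : ℝ × ℝ} {t : ℝ} (h : HasDerivAt Y y t) :
    HasDerivAt (fun t => (Y t).2) y.2 t :=
  (ContinuousLinearMap.snd ℝ ℝ ℝ).hasFDerivAt.comp_hasDerivAt t h

/-- The local solution is continued in t = log r. On the rectangle [0,2] × [0,1] the field vanishes
in p at p = 0, 2, vanishes in η at η = 1, and points inward at η = 0 because g ≥ 0. -/
theorem exists_global_profile {n k : ℕ} (hk : 0 < k) (hnk : n < 2 * k) {g₀ : ℝ} {g₁ : ℝ → ℝ}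
    {W : Set ℝ} (hW : IsOpen W) (hWI : Icc (0 : ℝ) 2 ⊆ W) (hg₁ : ContDiffOn ℝ ∞ g₁ W)
    (hg : ∀ p ∈ Icc (0 : ℝ) 2, 0 ≤ g₀ + p * g₁ p) {κ : ℝ} (hκ : 0 < κ) :
    ∃ δ > 0, ∃ P η : ℝ → ℝ, P 0 = κ ∧ η 0 = 0 ∧
      ContDiffOn ℝ ∞ P (Ioi (-δ)) ∧ ContDiffOn ℝ ∞ η (Ioi (-δ)) ∧
      ∀ τ, 0 < τ → 0 < τ * P τ ∧ τ * P τ < 2 ∧ 0 ≤ η τ ∧ η τ < 1 ∧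
        HasDerivAt (fun s => s * P s) (profileField₁ n k (τ * P τ, η τ) / (2 * τ)) τ ∧
        HasDerivAt η (profileField₂ n k (fun p => g₀ + p * g₁ p) (τ * P τ, η τ) / (2 * τ)) τ := by
  have hk' : (0 : ℝ) < k := by exact_mod_cast hk
  have hnk' : (n : ℝ) < 2 * k := by exact_mod_cast hnk
  have hn' : (0 : ℝ) ≤ n := Nat.cast_nonneg n
  obtain ⟨δ, hδ, P, η, hP0, hη0, hPc, hηc, hloc⟩ :=
    exists_local_profile hk hnk hW (hWI ⟨le_rfl, zero_le_two⟩) hg₁ hg hκ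
  obtain ⟨g, hgdef⟩ : ∃ g : ℝ → ℝ, g = fun p => g₀ + p * g₁ p := ⟨_, rfl⟩
  have hgc : ContDiffOn ℝ ∞ g W := by
    rw [hgdef]; exact contDiffOn_const.add (contDiffOn_id.mul hg₁)
  have hgnn : ∀ p ∈ Icc (0 : ℝ) 2, 0 ≤ g p := by rw [hgdef]; exact hg
  rw [← hgdef] at hloc ⊢
  set V : ℝ × ℝ → ℝ × ℝ := fun y => (profileField₁ n k y, profileField₂ n k g y) with hV
  set W' : Set (ℝ × ℝ) := {y | y.1 ∈ W} with hW'
  have hVc : ContDiffOn ℝ ∞ V W' := by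
    obtain ⟨G, hG⟩ : ∃ G : ℝ × ℝ → ℝ, ∀ y, G y = g y.1 := ⟨_, fun _ => rfl⟩
    have hGc : ContDiffOn ℝ ∞ G W' :=
      (hgc.comp (f := fun y : ℝ × ℝ => y.1) (by fun_prop) fun z hz => hz).congr fun y _ => hG y
    simp only [hV, profileField₁, profileField₂, ← hG]
    fun_prop
  set box : Set (ℝ × ℝ) := Icc 0 2 ×ˢ Icc 0 1 with hbox
  have hboxW : box ⊆ W' := fun y hy => hWI hy.1
  have hcomp : IsCompact box := isCompact_Icc.prod isCompact_Icc
  have hVbox : ContDiffOn ℝ 1 V box := (hVc.mono hboxW).of_le (by simp)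
  obtain ⟨K, hK⟩ := (hVbox.locallyLipschitzOn
    ((convex_Icc 0 2).prod (convex_Icc 0 1))).exists_lipschitzOnWith_of_compact hcomp
  obtain ⟨C, hC⟩ := hcomp.exists_bound_of_continuousOn hVbox.continuousOn
  -- Composing the field with the projection onto the rectangle makes it bounded and Lipschitz,
  -- hence complete. Confinement, proved afterwards, shows that the projection never acts.
  set cl : ℝ × ℝ → ℝ × ℝ := fun y =>
    ((projIcc 0 2 zero_le_two y.1 : ℝ), (projIcc 0 1 zero_le_one y.2 : ℝ)) with hcl
  have hclbox : ∀ y, cl y ∈ box := fun y => 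
    ⟨(projIcc 0 2 zero_le_two y.1).2, (projIcc 0 1 zero_le_one y.2).2⟩
  have hclid : ∀ y ∈ box, cl y = y := fun y hy => by
    simp only [hcl, projIcc_of_mem _ hy.1, projIcc_of_mem _ hy.2]
  have hclL : LipschitzWith 1 cl := by
    have h1 : LipschitzWith 1 fun y : ℝ × ℝ => (projIcc (0 : ℝ) 2 zero_le_two y.1 : ℝ) := by
      simpa [Function.comp_def] using (LipschitzWith.subtype_val _).comp
        ((LipschitzWith.projIcc zero_le_two).comp LipschitzWith.prod_fst)
    have h2 : LipschitzWith 1 fun y : ℝ × ℝ => (projIcc (0 : ℝ) 1 zero_le_one y.2 : ℝ) := by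
      simpa [Function.comp_def] using (LipschitzWith.subtype_val _).comp
        ((LipschitzWith.projIcc zero_le_one).comp LipschitzWith.prod_snd)
    simpa using h1.prodMk h2
  have hVcl : LipschitzWith (K * 1) (V ∘ cl) := by
    rw [← lipschitzOnWith_univ]
    exact hK.comp hclL.lipschitzOnWith fun y _ => hclbox y
  set t₀ := Real.log (δ / 2) / 2 with ht₀
  have hexp₀ : Real.exp (2 * t₀) = δ / 2 := by
    rw [ht₀, mul_div_cancel₀ _ two_ne_zero, Real.exp_log (by positivity)]
  set loc : ℝ → ℝ × ℝ := fun t =>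
    (Real.exp (2 * t) * P (Real.exp (2 * t)), η (Real.exp (2 * t))) with hlocdef
  obtain ⟨Y, hY0, hY⟩ := exists_hasDerivAt_of_bounded_lipschitz hVcl (L := C.toNNReal)
    (fun y => (hC _ (hclbox y)).trans (Real.le_coe_toNNReal C)) t₀ (loc t₀)
  have hlocbox : ∀ t, Real.exp (2 * t) < δ → loc t ∈ box := fun t ht => by
    obtain ⟨h1, h2, h3, h4, -⟩ := hloc _ ⟨Real.exp_pos _, ht⟩
    exact ⟨⟨h1.le, h2.le⟩, ⟨h3, h4.le⟩⟩
  have hlocder : ∀ t, Real.exp (2 * t) < δ → HasDerivAt loc ((V ∘ cl) (loc t)) t := fun t ht => by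
    obtain ⟨-, -, -, -, h5, h6⟩ := hloc _ ⟨Real.exp_pos _, ht⟩
    have he : HasDerivAt (fun t => Real.exp (2 * t)) (Real.exp (2 * t) * (2 * 1)) t :=
      ((hasDerivAt_id t).const_mul 2).exp
    rw [Function.comp_apply, hclid _ (hlocbox t ht)]
    have hne := Real.exp_ne_zero (2 * t)
    refine ((h5.comp t he).prodMk (h6.comp t he)).congr_deriv ?_
    simp only [hV, hlocdef]
    congr 1 <;> field_simp
  have hagree : ∀ t, Real.exp (2 * t) < δ → Y t = loc t := by
    intro t ht
    have hlt : ∀ s, Real.exp (2 * s) < δ ↔ s < Real.log δ / 2 := fun s => by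
      rw [← Real.lt_log_iff_exp_lt hδ, lt_div_iff₀ two_pos, mul_comm]
    refine ODE_solution_unique_of_mem_Ioo (v := fun _ => V ∘ cl) (s := fun _ => univ) (K := K * 1)
      (fun _ _ => hVcl.lipschitzOnWith) (t₀ := t₀) (a := min t t₀ - 1) (b := Real.log δ / 2)
      ⟨by linarith [min_le_right t t₀], ?_⟩ (fun s _ => ⟨hY s, trivial⟩)
      (fun s hs => ⟨hlocder s ((hlt s).2 hs.2), trivial⟩) hY0
      ⟨by linarith [min_le_left t t₀], (hlt t).1 ht⟩
    rw [← hlt, hexp₀]; linarith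
  have hY1 : ∀ t, HasDerivAt (fun t => (Y t).1) ((V (cl (Y t))).1) t := fun t =>
    hasDerivAt_fst (hY t)
  have hY2 : ∀ t, HasDerivAt (fun t => (Y t).2) ((V (cl (Y t))).2) t := fun t =>
    hasDerivAt_snd (hY t)
  obtain ⟨h01, h02, h03, h04, -⟩ := hloc (δ / 2) ⟨by linarith, by linarith⟩
  have hY0' : Y t₀ = (δ / 2 * P (δ / 2), η (δ / 2)) := by rw [hY0, hlocdef]; simp only [hexp₀]
  have hfac : ∀ b ∈ Icc (0 : ℝ) 1, 0 ≤ 2 - n / k * b ∧ 2 - n / k * b ≤ 2 := by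
    intro b hb
    have h1 : (n : ℝ) / k ≤ 2 := by rw [div_le_iff₀ hk']; exact hnk'.le
    have h2 : 0 ≤ (n : ℝ) / k := by positivity
    constructor <;> nlinarith [hb.1, hb.2]
  -- The projection is 1-Lipschitz and fixes the edges, so the projected point is no farther from an
  -- edge than the actual point. This yields the linear differential inequalities for p, 2 − p, η
  -- and 1 − η.
  have hfwd : ∀ t, t₀ ≤ t → 0 < (Y t).1 ∧ (Y t).1 < 2 ∧ 0 ≤ (Y t).2 ∧ (Y t).2 < 1 := by
    obtain ⟨M, hM⟩ := isCompact_Icc.exists_bound_of_continuousOn (hgc.continuousOn.mono hWI)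
    have hY1pos := pos_of_neg_mul_abs_le_deriv (φ := fun t => (Y t).1) (K := 0) (t₀ := t₀)
      (fun t _ => hY1 t) (fun t _ => by
        obtain ⟨ha, hb⟩ := hclbox (Y t)
        simp only [hV, profileField₁]
        simpa using mul_nonneg (mul_nonneg ha.1 (by linarith [ha.2])) (hfac _ hb).1)
      (by simpa only [hY0'] using h01)
    have hY1lt := pos_of_neg_mul_abs_le_deriv (φ := fun t => 2 - (Y t).1) (K := 2) (t₀ := t₀)
      (fun t _ => (hY1 t).const_sub 2) (fun t _ => by
        obtain ⟨ha, hb⟩ := hclbox (Y t)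
        obtain ⟨hb1, hb2⟩ := hfac _ hb
        have h5 : |2 - (cl (Y t)).1| ≤ |2 - (Y t).1| :=
          abs_sub_projIcc_le zero_le_two ⟨zero_le_two, le_rfl⟩ _
        rw [abs_of_nonneg (by linarith [ha.2])] at h5
        simp only [hV, profileField₁]
        have h6 : (cl (Y t)).1 * (1 - (cl (Y t)).1 / 2) ≤ 2 - (cl (Y t)).1 := by
          nlinarith [ha.1, ha.2]
        have h7 : 0 ≤ (cl (Y t)).1 * (1 - (cl (Y t)).1 / 2) :=
          mul_nonneg ha.1 (by linarith [ha.2])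
        nlinarith) (by simp only [hY0']; linarith)
    have hY2nn := nonneg_of_neg_mul_abs_le_deriv (φ := fun t => (Y t).2) (K := n) (t₀ := t₀)
      (fun t _ => hY2 t) (fun t _ => by
        obtain ⟨ha, hb⟩ := hclbox (Y t)
        have h5 : |0 - (cl (Y t)).2| ≤ |0 - (Y t).2| :=
          abs_sub_projIcc_le zero_le_one ⟨le_rfl, zero_le_one⟩ _
        rw [zero_sub, zero_sub, abs_neg, abs_neg, abs_of_nonneg hb.1] at h5
        simp only [hV, profileField₂]
        generalize (cl (Y t)).1 = a at *
        generalize (cl (Y t)).2 = b at *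
        have h6 : 0 ≤ (1 - b) * (a * g a * (2 * k - n * b)) :=
          mul_nonneg (by linarith [hb.2]) (mul_nonneg (mul_nonneg ha.1 (hgnn a ha))
            (by nlinarith [hb.1, hb.2]))
        have h7 : (1 - b) * (1 - a) ≤ 1 := by nlinarith [hb.1, hb.2, ha.1, ha.2]
        have h8 : n * b * ((1 - b) * (1 - a)) ≤ n * b :=
          mul_le_of_le_one_right (mul_nonneg hn' hb.1) h7
        have h9 : n * b ≤ n * |(Y t).2| := by gcongr
        linarith) (by simpa only [hY0'] using h03)
    have hY2lt := pos_of_neg_mul_abs_le_deriv (φ := fun t => 1 - (Y t).2) (K := 2 * M * (2 * k) + n)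
      (t₀ := t₀) (fun t _ => (hY2 t).const_sub 1) (fun t _ => by
        obtain ⟨ha, hb⟩ := hclbox (Y t)
        have h5 : |1 - (cl (Y t)).2| ≤ |1 - (Y t).2| :=
          abs_sub_projIcc_le zero_le_one ⟨zero_le_one, le_rfl⟩ _
        rw [abs_of_nonneg (by linarith [hb.2])] at h5
        simp only [hV, profileField₂]
        generalize (cl (Y t)).1 = a at *
        generalize (cl (Y t)).2 = b at *
        have hMa : g a ≤ M := (le_abs_self _).trans (hM a ha)
        have hM0 : 0 ≤ M := (hgnn a ha).trans hMa
        have h6 : a * g a * (2 * k - n * b) ≤ 2 * M * (2 * k) :=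
          mul_le_mul (mul_le_mul ha.2 hMa (hgnn a ha) zero_le_two)
            (by nlinarith [mul_nonneg hn' hb.1]) (by nlinarith [hb.1, hb.2]) (by positivity)
        have h7 : -(n * (1 - a) * b) ≤ n := by
          have : (a - 1) * b ≤ 1 := by nlinarith [hb.1, hb.2, ha.1, ha.2]
          nlinarith
        have h8 : (1 - b) * (a * g a * (2 * k - n * b) - n * (1 - a) * b)
            ≤ (1 - b) * (2 * M * (2 * k) + n) :=
          mul_le_mul_of_nonneg_left (by linarith) (by linarith [hb.2])
        have h9 : (2 * M * (2 * k) + n) * (1 - b) ≤ (2 * M * (2 * k) + n) * |1 - (Y t).2| :=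
          mul_le_mul_of_nonneg_left h5 (by positivity)
        linarith) (by simp only [hY0']; linarith)
    exact fun t ht => ⟨hY1pos t ht, by linarith [hY1lt t ht], hY2nn t ht, by linarith [hY2lt t ht]⟩
  have hYbox : ∀ t, 0 < (Y t).1 ∧ (Y t).1 < 2 ∧ 0 ≤ (Y t).2 ∧ (Y t).2 < 1 := by
    intro t
    rcases lt_or_ge t t₀ with h | h
    · have h1 : Real.exp (2 * t) < δ := by
        have : Real.exp (2 * t) < Real.exp (2 * t₀) := Real.exp_lt_exp.2 (by linarith)
        rw [hexp₀] at this; linarith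
      obtain ⟨a1, a2, a3, a4, -⟩ := hloc _ ⟨Real.exp_pos _, h1⟩
      rw [hagree t h1]
      exact ⟨a1, a2, a3, a4⟩
    · exact hfwd t h
  have hYV : ∀ t, HasDerivAt Y (V (Y t)) t := fun t => by
    obtain ⟨a1, a2, a3, a4⟩ := hYbox t
    have := hY t
    rwa [Function.comp_apply, hclid (Y t) ⟨⟨a1.le, a2.le⟩, ⟨a3, a4.le⟩⟩] at this
  have hYc : ContDiff ℝ ∞ Y := by
    rw [← contDiffOn_univ]
    exact contDiffOn_of_hasDerivAt hVc isOpen_univ (fun t _ => hYV t)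
      fun t _ => hWI ⟨(hYbox t).1.le, (hYbox t).2.1.le⟩
  set lg : ℝ → ℝ := fun τ => Real.log τ / 2 with hlg
  have hlgexp : ∀ τ, 0 < τ → Real.exp (2 * lg τ) = τ := fun τ hτ => by
    rw [hlg]; simp only; rw [mul_div_cancel₀ _ two_ne_zero, Real.exp_log hτ]
  have hlgd : ∀ τ, 0 < τ → HasDerivAt lg (1 / (2 * τ)) τ := fun τ hτ => by
    refine ((Real.hasDerivAt_log hτ.ne').div_const 2).congr_deriv ?_
    field_simp
  -- The local solution keeps smoothness at 0. By uniqueness it agrees with the global one on (0,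
  -- δ), so the gluing is smooth at δ.
  set P' : ℝ → ℝ := fun τ => if τ < δ then P τ else (Y (lg τ)).1 / τ with hP'
  set η' : ℝ → ℝ := fun τ => if τ < δ then η τ else (Y (lg τ)).2 with hη'
  have hP'Y : ∀ τ, 0 < τ → τ * P' τ = (Y (lg τ)).1 := fun τ hτ => by
    simp only [hP']
    split_ifs with h
    · rw [hagree _ (by rwa [hlgexp τ hτ]), hlocdef]; simp only [hlgexp τ hτ]
    · field_simp
  have hη'Y : ∀ τ, 0 < τ → η' τ = (Y (lg τ)).2 := fun τ hτ => by
    simp only [hη']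
    split_ifs with h
    · rw [hagree _ (by rwa [hlgexp τ hτ]), hlocdef]; simp only [hlgexp τ hτ]
    · rfl
  have hlgc : ∀ τ, 0 < τ → ContDiffAt ℝ ∞ (fun s => Y (lg s)) τ := fun τ hτ =>
    hYc.contDiffAt.comp τ ((Real.contDiffAt_log.2 hτ.ne').div_const 2)
  refine ⟨δ, hδ, P', η', by simp [hP', hδ, hP0], by simp [hη', hδ, hη0], ?_, ?_, fun τ hτ => ?_⟩
  · intro τ hτ
    refine ContDiffAt.contDiffWithinAt ?_
    rcases lt_or_ge τ δ with h | h
    · refine (hPc.contDiffAt (isOpen_Ioo.mem_nhds ⟨hτ, h⟩)).congr_of_eventuallyEq ?_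
      filter_upwards [gt_mem_nhds h] with s hs
      simp [hP', hs]
    · have hτ0 : 0 < τ := hδ.trans_le h
      refine ((hlgc τ hτ0).fst.div contDiffAt_id hτ0.ne').congr_of_eventuallyEq ?_
      filter_upwards [lt_mem_nhds hτ0] with s hs
      simp only [Pi.div_apply, id_eq]
      rw [← hP'Y s hs]; field_simp
  · intro τ hτ
    refine ContDiffAt.contDiffWithinAt ?_
    rcases lt_or_ge τ δ with h | h
    · refine (hηc.contDiffAt (isOpen_Ioo.mem_nhds ⟨hτ, h⟩)).congr_of_eventuallyEq ?_
      filter_upwards [gt_mem_nhds h] with s hs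
      simp [hη', hs]
    · have hτ0 : 0 < τ := hδ.trans_le h
      refine (hlgc τ hτ0).snd.congr_of_eventuallyEq ?_
      filter_upwards [lt_mem_nhds hτ0] with s hs using hη'Y s hs
  · obtain ⟨a1, a2, a3, a4⟩ := hYbox (lg τ)
    have hd1 : HasDerivAt (fun s => (Y (lg s)).1) ((V (Y (lg τ))).1 * (1 / (2 * τ))) τ :=
      (hasDerivAt_fst (hYV (lg τ))).comp τ (hlgd τ hτ)
    have hd2 : HasDerivAt (fun s => (Y (lg s)).2) ((V (Y (lg τ))).2 * (1 / (2 * τ))) τ :=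
      (hasDerivAt_snd (hYV (lg τ))).comp τ (hlgd τ hτ)
    rw [hP'Y τ hτ, hη'Y τ hτ]
    refine ⟨a1, a2, a3, a4, ?_, ?_⟩
    · refine (hd1.congr_of_eventuallyEq ?_).congr_deriv (by rw [mul_one_div])
      filter_upwards [lt_mem_nhds hτ] with s hs using hP'Y s hs
    · refine (hd2.congr_of_eventuallyEq ?_).congr_deriv (by rw [mul_one_div])
      filter_upwards [lt_mem_nhds hτ] with s hs using hη'Y s hs

end KYamabe

/-! ## The first integral -/

namespace KYamabe

open Set
open scoped ContDiff

/-- The quotient g(p) = θ(2−p)/F(p), split as g(0) + p g₁(p). If ρ > 2θ, then F > 0 on [0,2]. If ρ =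
2θ, F vanishes at p = 2 but the common factor 2 − p cancels and g is constantly 1/2. -/
theorem exists_soliton_coefficient {θ ρ : ℝ} (hθ : 0 ≤ θ) (h0 : 0 < 2 * θ + ρ) (hρ : 2 * θ ≤ ρ) :
    ∃ (g₀ : ℝ) (g₁ : ℝ → ℝ) (W : Set ℝ), IsOpen W ∧ Icc (0 : ℝ) 2 ⊆ W ∧ ContDiffOn ℝ ∞ g₁ W ∧
      (∀ p ∈ Icc (0 : ℝ) 2, 0 ≤ g₀ + p * g₁ p) ∧
      ∀ p, 2 * θ + ρ - 2 * θ * p ≠ 0 →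
        (g₀ + p * g₁ p) * (2 * θ + ρ - 2 * θ * p) = θ * (2 - p) := by
  rcases hρ.eq_or_lt with rfl | hlt
  · refine ⟨1 / 2, fun _ => 0, univ, isOpen_univ, subset_univ _, contDiffOn_const, ?_, ?_⟩
    · intro p _; norm_num
    · intro p _; ring
  · have hval : ∀ p, 2 * θ + ρ - 2 * θ * p ≠ 0 →
        (2 * θ / (2 * θ + ρ) + p * (-(θ * (ρ - 2 * θ)) / ((2 * θ + ρ - 2 * θ * p) * (2 * θ + ρ))))
          * (2 * θ + ρ - 2 * θ * p) = θ * (2 - p) := by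
      intro p hp
      have := h0.ne'
      field_simp
      ring
    have hF : ∀ p ∈ Icc (0 : ℝ) 2, 0 < 2 * θ + ρ - 2 * θ * p := fun p hp => by
      nlinarith [mul_nonneg hθ (by linarith [hp.2] : 0 ≤ 2 - p)]
    refine ⟨2 * θ / (2 * θ + ρ),
      fun p => -(θ * (ρ - 2 * θ)) / ((2 * θ + ρ - 2 * θ * p) * (2 * θ + ρ)),
      {p | 2 * θ + ρ - 2 * θ * p ≠ 0}, isOpen_ne.preimage (by fun_prop),
      fun p hp => (hF p hp).ne', ?_, fun p hp => ?_, hval⟩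
    · exact contDiffOn_const.div (by fun_prop) fun p hp => mul_ne_zero hp h0.ne'
    · have h1 := hval p (hF p hp).ne'
      have h2 : 0 ≤ θ * (2 - p) := mul_nonneg hθ (by linarith [hp.2])
      rw [← h1] at h2
      exact nonneg_of_mul_nonneg_left h2 (hF p hp)

/-- The value of the elementary symmetric functions on the eigenvalues of the soliton profile. -/
theorem mul_radialSigma_profile {n i : ℕ} (hin : i ≤ n) (hi : 0 < i) (Q e : ℝ) :
    (i : ℝ) * radialSigma n (i - 1) (Q * (1 - n * e)) Q
      = ((n - 1).choose (i - 1) : ℝ) * n * Q ^ i * (1 - i * e) := by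
  rw [radialSigma_eq hin hi]
  obtain ⟨j, rfl⟩ : ∃ j, i = j + 1 := ⟨i - 1, by omega⟩
  simp only [Nat.add_sub_cancel, pow_succ]
  push_cast
  ring

theorem mul_choose_pred {n k : ℕ} (hk : 0 < k) (hkn : k ≤ n) :
    (n : ℝ) * ((n - 1).choose (k - 1) : ℝ) = k * (n.choose k : ℝ) := by
  obtain ⟨j, rfl⟩ : ∃ j, k = j + 1 := ⟨k - 1, by omega⟩
  obtain ⟨N, rfl⟩ : ∃ N, n = N + 1 := ⟨n - 1, by omega⟩
  have := Nat.add_one_mul_choose_eq N j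
  simp only [Nat.add_sub_cancel]
  rw [mul_comm ((j + 1 : ℕ) : ℝ)]
  exact_mod_cast this

/-- Global radial profiles: `v = exp (S (|x|²))`, with `S' = P / 2`. -/
theorem exists_log_profile {n k : ℕ} (hkn : k ≤ n) (hk : 0 < k) (hnk : n < 2 * k) {θ ρ : ℝ}
    (hθ : 0 ≤ θ) (h0 : 0 < 2 * θ + ρ) (hρ : 2 * θ ≤ ρ) (S₀ : ℝ) :
    ∃ δ > 0, ∃ S P P' η : ℝ → ℝ, S 0 = S₀ ∧ ContDiffOn ℝ ∞ S (Ioi (-δ)) ∧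
      (∀ τ, -δ < τ → HasDerivAt S (P τ / 2) τ ∧ HasDerivAt P (P' τ) τ) ∧
      (∀ τ, 0 ≤ τ → 0 < P τ ∧ τ * P τ < 2 ∧ 0 ≤ η τ ∧ η τ < 1 ∧
        0 < 2 * θ + ρ - 2 * θ * (τ * P τ) ∧
        2 * τ * P' τ = P τ * (1 - τ * P τ / 2) * (2 - n / k * η τ) - 2 * P τ ∧
        (n.choose k : ℝ) * (P τ * (1 - τ * P τ / 2)) ^ k * (1 - η τ) * (Real.exp (S τ) ^ k) ^ 2
          = (2 * θ + ρ - 2 * θ * (τ * P τ)) ^ k) := by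
  have hk' : (0 : ℝ) < k := by exact_mod_cast hk
  have hNpos : (0 : ℝ) < n.choose k := by exact_mod_cast Nat.choose_pos hkn
  obtain ⟨g₀, g₁, W, hW, hWI, hg₁, hgnn, hgF⟩ := exists_soliton_coefficient hθ h0 hρ
  set ν : ℝ := Real.exp (-(Real.log (n.choose k : ℝ) / k)) with hν
  -- At τ = 0, where b = κ and η = 0, the required relation is C(n,k) κ^k e^{2kS₀} = (2θ+ρ)^k, which
  -- determines κ.
  set κ : ℝ := (2 * θ + ρ) * ν * Real.exp (-(2 * S₀)) with hκ
  have hκpos : 0 < κ := by positivity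
  obtain ⟨δ, hδ, P, η, hP0, hη0, hPc, hηc, hsys⟩ :=
    exists_global_profile hk hnk hW hWI hg₁ hgnn hκpos
  have hPcont : ContinuousOn P (Ioi (-δ)) := hPc.continuousOn
  set S : ℝ → ℝ := fun τ => S₀ + (∫ s in (0 : ℝ)..τ, P s) / 2 with hS
  have hSd : ∀ τ, -δ < τ → HasDerivAt S (P τ / 2) τ := by
    intro τ hτ
    have hsub : uIcc 0 τ ⊆ Ioi (-δ) := fun s hs =>
      lt_of_lt_of_le (lt_min (by linarith) hτ) hs.1
    have hnh : Ioi (-δ) ∈ nhds τ := isOpen_Ioi.mem_nhds hτ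
    exact ((intervalIntegral.integral_hasDerivAt_right
      (hPcont.mono hsub).intervalIntegrable
      (hPcont.stronglyMeasurableAtFilter isOpen_Ioi τ hτ)
      (hPcont.continuousAt hnh)).div_const 2).const_add S₀
  have hSc : ContDiffOn ℝ ∞ S (Ioi (-δ)) := by
    rw [contDiffOn_infty_iff_deriv_of_isOpen isOpen_Ioi]
    exact ⟨fun τ hτ => (hSd τ hτ).differentiableAt.differentiableWithinAt,
      (hPc.div_const 2).congr fun τ hτ => (hSd τ hτ).deriv⟩
  have hPd : ∀ τ, -δ < τ → HasDerivAt P (deriv P τ) τ := fun τ hτ =>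
    ((hPc.contDiffAt (isOpen_Ioi.mem_nhds hτ)).differentiableAt (by simp)).hasDerivAt
  have hPpos : ∀ τ, 0 ≤ τ → 0 < P τ := by
    intro τ hτ
    rcases hτ.eq_or_lt with rfl | hτ
    · rw [hP0]; exact hκpos
    · exact pos_of_mul_pos_right (hsys τ hτ).1 hτ.le
  have hp2 : ∀ τ, 0 ≤ τ → τ * P τ < 2 := by
    intro τ hτ
    rcases hτ.eq_or_lt with rfl | hτ
    · simp
    · exact (hsys τ hτ).2.1
  have hη : ∀ τ, 0 ≤ τ → 0 ≤ η τ ∧ η τ < 1 := by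
    intro τ hτ
    rcases hτ.eq_or_lt with rfl | hτ
    · simp [hη0]
    · exact ⟨(hsys τ hτ).2.2.1, (hsys τ hτ).2.2.2.1⟩
  have hF : ∀ τ, 0 ≤ τ → 0 < 2 * θ + ρ - 2 * θ * (τ * P τ) := by
    intro τ hτ
    rcases hθ.eq_or_lt with rfl | hθ
    · linarith
    · nlinarith [mul_pos hθ (sub_pos.2 (hp2 τ hτ))]
  have hP' : ∀ τ, 0 < τ →
      P τ + τ * deriv P τ = P τ * (1 - τ * P τ / 2) * (2 - n / k * η τ) / 2 := by
    intro τ hτ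
    have h1 := ((hasDerivAt_id τ).mul (hPd τ (by linarith))).unique (hsys τ hτ).2.2.2.2.1
    simp only [profileField₁, id_eq, one_mul] at h1
    rw [h1]
    field_simp
  -- Up to the constant log C(n,k), this is the logarithm of the ratio of the two sides of the first
  -- integral. It is differentiated only for τ > 0, and continuity at 0 then fixes its value.
  set L : ℝ → ℝ := fun τ => k * (Real.log (P τ) + Real.log (1 - τ * P τ / 2)) + 2 * k * S τ
    + Real.log (1 - η τ) - k * Real.log (2 * θ + ρ - 2 * θ * (τ * P τ)) with hL
  have hLcont : ContinuousOn L (Ici 0) := by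
    have hsub : Ici (0 : ℝ) ⊆ Ioi (-δ) := fun τ hτ =>
      lt_of_lt_of_le (neg_lt_zero.2 hδ) hτ
    have c1 := hPcont.mono hsub
    have c2 := hSc.continuousOn.mono hsub
    have c3 := hηc.continuousOn.mono hsub
    have c4 : ContinuousOn (fun τ => τ * P τ) (Ici 0) := continuousOn_id.mul c1
    refine ((((continuousOn_const.mul ((c1.log fun τ hτ => (hPpos τ hτ).ne').add
      ((continuousOn_const.sub (c4.div_const 2)).log fun τ hτ => ?_))).add
      (continuousOn_const.mul c2)).add ((continuousOn_const.sub c3).log fun τ hτ => ?_))).sub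
      (continuousOn_const.mul ((continuousOn_const.sub (continuousOn_const.mul c4)).log
        fun τ hτ => (hF τ hτ).ne'))
    · have := hp2 τ hτ; exact (by linarith : 0 < 1 - τ * P τ / 2).ne'
    · exact (sub_pos.2 (hη τ hτ).2).ne'
  have hLd : ∀ τ, 0 < τ → HasDerivAt L 0 τ := by
    intro τ hτ
    have hPτ := hPpos τ hτ.le
    have h2 := hp2 τ hτ.le
    have hητ := sub_pos.2 (hη τ hτ.le).2
    have hFτ := hF τ hτ.le
    have h3 : 0 < 1 - τ * P τ / 2 := by linarith
    have hd1 := hPd τ (by linarith)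
    have hd2 : HasDerivAt (fun s => s * P s) (1 * P τ + τ * deriv P τ) τ :=
      (hasDerivAt_id τ).mul hd1
    have hd3 := (hsys τ hτ).2.2.2.2.2
    have hd := ((((hd1.log hPτ.ne').add
      (((hd2.div_const 2).const_sub 1).log h3.ne')).const_mul (k : ℝ)).add
      ((hSd τ (by linarith)).const_mul (2 * (k : ℝ)))).add ((hd3.const_sub 1).log hητ.ne')
    have hd' := hd.sub (((hd2.const_mul (2 * θ)).const_sub (2 * θ + ρ)).log hFτ.ne' |>.const_mul
      (k : ℝ))
    refine hd'.congr_deriv ?_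
    have hPe := hP' τ hτ
    have hg := hgF (τ * P τ) hFτ.ne'
    rw [one_mul, hPe]
    have e0 : deriv P τ = (P τ * (1 - τ * P τ / 2) * (2 - n / k * η τ) / 2 - P τ) / τ := by
      rw [eq_div_iff hτ.ne']; linarith
    rw [e0]
    simp only [profileField₂]
    generalize g₀ + τ * P τ * g₁ (τ * P τ) = G at hg ⊢
    generalize 2 * θ + ρ - 2 * θ * (τ * P τ) = F at hg hFτ ⊢
    have e1 : (P τ * (1 - τ * P τ / 2) * (2 - n / k * η τ) / 2 - P τ) / τ / P τ
        = ((1 - τ * P τ / 2) * (2 - n / k * η τ) / 2 - 1) / τ := by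
      field_simp
    have e2 : -(P τ * (1 - τ * P τ / 2) * (2 - n / k * η τ) / 2 / 2) / (1 - τ * P τ / 2)
        = -(P τ * (2 - n / k * η τ) / 4) := by
      rw [div_eq_iff h3.ne']; ring
    have e3 : -((1 - η τ) * (τ * P τ * G * (2 * k - n * η τ) - n * (1 - τ * P τ) * η τ) / (2 * τ))
          / (1 - η τ)
        = -((τ * P τ * G * (2 * k - n * η τ) - n * (1 - τ * P τ) * η τ) / (2 * τ)) := by
      field_simp
    have e4 : -(2 * θ * (P τ * (1 - τ * P τ / 2) * (2 - n / k * η τ) / 2)) / F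
        = -(P τ * G * (2 - n / k * η τ) / 2) := by
      rw [div_eq_iff hFτ.ne']
      linear_combination (P τ * (2 - n / k * η τ) / 2) * hg
    rw [e1, e2, e3, e4]
    field_simp
    ring
  have hLconst : ∀ τ, 0 ≤ τ → L τ = L 0 := by
    intro τ hτ
    have hmono : MonotoneOn L (Ici 0) := monotoneOn_of_deriv_nonneg (convex_Ici 0) hLcont
      (fun s hs => by
        rw [interior_Ici] at hs
        exact (hLd s hs).differentiableAt.differentiableWithinAt)
      (fun s hs => by rw [interior_Ici] at hs; rw [(hLd s hs).deriv])
    have hanti : AntitoneOn L (Ici 0) := antitoneOn_of_deriv_nonpos (convex_Ici 0) hLcont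
      (fun s hs => by
        rw [interior_Ici] at hs
        exact (hLd s hs).differentiableAt.differentiableWithinAt)
      (fun s hs => by rw [interior_Ici] at hs; rw [(hLd s hs).deriv])
    exact le_antisymm (hanti self_mem_Ici hτ hτ) (hmono self_mem_Ici hτ hτ)
  have hS0 : S 0 = S₀ := by simp [hS]
  have hL0 : L 0 = -Real.log (n.choose k : ℝ) := by
    simp only [hL, hP0, hη0, hS0, hκ]
    rw [Real.log_mul (by positivity) (Real.exp_ne_zero _), Real.log_mul h0.ne' (Real.exp_ne_zero _),
      Real.log_exp, Real.log_exp]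
    simp only [zero_mul, zero_div, sub_zero, mul_zero, Real.log_one]
    field_simp
    ring
  refine ⟨δ, hδ, S, P, deriv P, η, hS0, hSc, fun τ hτ => ⟨hSd τ hτ, hPd τ hτ⟩, fun τ hτ =>
    ⟨hPpos τ hτ, hp2 τ hτ, (hη τ hτ).1, (hη τ hτ).2, hF τ hτ, ?_, ?_⟩⟩
  · rcases hτ.eq_or_lt with rfl | hτ
    · simp [hη0]; ring
    · linarith [hP' τ hτ]
  · have hPτ := hPpos τ hτ
    have h2 := hp2 τ hτ
    have hητ := sub_pos.2 (hη τ hτ).2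
    have hFτ := hF τ hτ
    have h3 : 0 < 1 - τ * P τ / 2 := by linarith
    have h4 := (hLconst τ hτ).trans hL0
    refine Real.log_injOn_pos (mem_Ioi.2 (by positivity)) (mem_Ioi.2 (by positivity)) ?_
    rw [Real.log_mul (by positivity) (by positivity), Real.log_mul (by positivity) hητ.ne',
      Real.log_mul hNpos.ne' (by positivity), Real.log_pow, Real.log_mul hPτ.ne' h3.ne',
      Real.log_pow, Real.log_pow, Real.log_pow, Real.log_exp]
    simp only [hL] at h4
    push_cast
    linarith

end KYamabe

/-! ## Growth at infinity and the main theorem -/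

namespace KYamabe

open Set
open scoped ContDiff

/-- Lower bound for the growth of the profile at infinity. -/
theorem exists_log_profile_lower_bound {n k : ℕ} (hk : 0 < k) (hnk : n < 2 * k)
    {S P P' η : ℝ → ℝ} (hS : ∀ τ, 0 < τ → HasDerivAt S (P τ / 2) τ)
    (hP : ∀ τ, 0 < τ → HasDerivAt P (P' τ) τ)
    (h : ∀ τ, 0 < τ → 0 < P τ ∧ τ * P τ < 2 ∧ η τ < 1 ∧
      2 * τ * P' τ = P τ * (1 - τ * P τ / 2) * (2 - n / k * η τ) - 2 * P τ) :
    ∃ C, ∀ τ, 1 ≤ τ → Real.log τ - C ≤ S τ := by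
  have hk' : (0 : ℝ) < k := by exact_mod_cast hk
  have hnk' : (n : ℝ) / k < 2 := by
    rw [div_lt_iff₀ hk']; exact_mod_cast hnk
  have hnn : (0 : ℝ) ≤ (n : ℝ) / k := by positivity
  set c : ℝ := 2 - n / k with hc
  have hcpos : 0 < c := by linarith
  -- With p = τP, (S − log τ)' = −(1 − p/2)/τ while (log p)' ≥ (c/2)(1 − p/2)/τ, so the multiple 2/c
  -- of log p compensates the loss. Since p < 2, the added term is bounded above.
  set M : ℝ → ℝ := fun τ => S τ - Real.log τ + 2 / c * (Real.log τ + Real.log (P τ)) with hM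
  have hMd : ∀ τ, 0 < τ → HasDerivAt M
      (P τ / 2 - τ⁻¹ + 2 / c * (τ⁻¹ + P' τ / P τ)) τ := fun τ hτ =>
    ((hS τ hτ).sub (Real.hasDerivAt_log hτ.ne')).add
      (((Real.hasDerivAt_log hτ.ne').add ((hP τ hτ).log (h τ hτ).1.ne')).const_mul _)
  have hnonneg : ∀ τ, 0 < τ → 0 ≤ P τ / 2 - τ⁻¹ + 2 / c * (τ⁻¹ + P' τ / P τ) := by
    intro τ hτ
    obtain ⟨h1, h2, h3, h4⟩ := h τ hτ
    have e : τ⁻¹ + P' τ / P τ = (1 - τ * P τ / 2) * (2 - n / k * η τ) / 2 / τ := by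
      have : P' τ = (P τ * (1 - τ * P τ / 2) * (2 - n / k * η τ) - 2 * P τ) / (2 * τ) := by
        rw [eq_div_iff (by positivity)]; linarith
      rw [this]
      generalize (2 - n / k * η τ) = X
      field_simp
      ring
    have h5 : c ≤ 2 - n / k * η τ := by nlinarith
    have h6 : 0 ≤ 1 - τ * P τ / 2 := by linarith
    have h7 : (1 - τ * P τ / 2) / τ ≤ 2 / c * (τ⁻¹ + P' τ / P τ) := by
      rw [e]
      calc (1 - τ * P τ / 2) / τ = 2 / c * ((1 - τ * P τ / 2) * c / 2 / τ) := by field_simp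
        _ ≤ _ := by gcongr
    have h8 : P τ / 2 - τ⁻¹ = -((1 - τ * P τ / 2) / τ) := by field_simp; ring
    linarith
  have hmono : MonotoneOn M (Ici 1) := monotoneOn_of_deriv_nonneg (convex_Ici 1)
    (fun τ hτ => (hMd τ (one_pos.trans_le hτ)).continuousAt.continuousWithinAt)
    (fun τ hτ => by
      rw [interior_Ici] at hτ
      exact (hMd τ (one_pos.trans hτ)).differentiableAt.differentiableWithinAt)
    (fun τ hτ => by
      rw [interior_Ici] at hτ
      rw [(hMd τ (one_pos.trans hτ)).deriv]
      exact hnonneg τ (one_pos.trans hτ))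
  refine ⟨2 / c * Real.log 2 - M 1, fun τ hτ => ?_⟩
  have hτ0 : 0 < τ := one_pos.trans_le hτ
  obtain ⟨h1, h2, -⟩ := h τ hτ0
  have h3 := hmono self_mem_Ici hτ hτ
  have h4 : Real.log τ + Real.log (P τ) ≤ Real.log 2 := by
    rw [← Real.log_mul hτ0.ne' h1.ne']
    exact Real.log_le_log (by positivity) h2.le
  have h5 : 2 / c * (Real.log τ + Real.log (P τ)) ≤ 2 / c * Real.log 2 := by gcongr
  have h6 : M τ = S τ - Real.log τ + 2 / c * (Real.log τ + Real.log (P τ)) := rfl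
  linarith

theorem two_le_infty : (2 : WithTop ℕ∞) ≤ ∞ :=
  show ((2 : ℕ∞) : WithTop ℕ∞) ≤ ∞ from WithTop.coe_le_coe.2 le_top

theorem exists_admissible_radial_solution {n k : ℕ} (hn : 3 ≤ n) (hkn : k ≤ n) (hnk : n < 2 * k)
    {θ ρ : ℝ} (hθ : 0 ≤ θ) (h0 : 0 < 2 * θ + ρ) (hρ : 2 * θ ≤ ρ) {α : ℝ} (hα : 0 < α) :
    ∃ u : E n → ℝ, ContDiff ℝ ∞ u ∧ IsAdmissibleRadialSolution k θ ρ u ∧ u 0 = α ∧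
      Asymptotics.IsBigO (Filter.cocompact (E n)) u
        (fun x => ‖x‖ ^ (-(((n : ℝ) + 2 * k) / k))) := by
  have hk : 0 < k := by omega
  have hk' : (0 : ℝ) < k := by exact_mod_cast hk
  have hn' : (0 : ℝ) < n := by exact_mod_cast (by omega : 0 < n)
  -- Here u = v^{-A}, so u(0) = α amounts to S(0) = −(log α)/A, and S ≥ log τ − C gives u =
  -- O(|x|^{-2A}).
  set A : ℝ := ((n : ℝ) + 2 * k) / (2 * k) with hA
  have hApos : 0 < A := by positivity
  obtain ⟨δ, hδ, S, P, P', η, hS0, hSc, hd, hprof⟩ :=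
    exists_log_profile hkn hk hnk hθ h0 hρ (-(Real.log α / A))
  have hδ' : ∀ τ : ℝ, 0 ≤ τ → -δ < τ := fun τ hτ => by linarith
  set u : E n → ℝ := fun x => Real.exp (-A * S (‖x‖ ^ 2)) with hu
  have hSat : ∀ x : E n, ContDiffAt ℝ ∞ S (‖x‖ ^ 2) := fun x =>
    hSc.contDiffAt (isOpen_Ioi.mem_nhds (hδ' _ (sq_nonneg _)))
  have huc : ContDiff ℝ ∞ u := contDiff_iff_contDiffAt.2 fun x =>
    (contDiffAt_const.mul ((hSat x).comp x (contDiff_norm_sq ℝ).contDiffAt)).exp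
  have hupos : ∀ x, 0 < u x := fun x => Real.exp_pos _
  have huS : ∀ x : E n, ∀ᶠ y in nhds x, u y = Real.exp (-A * S (‖y‖ ^ 2)) := fun x =>
    Filter.Eventually.of_forall fun y => rfl
  have hS2 : ∀ x : E n, ContDiffAt ℝ 2 S (‖x‖ ^ 2) := fun x => (hSat x).of_le two_le_infty
  have huc2 : ContDiff ℝ 2 u := huc.of_le two_le_infty
  have hderiv : ∀ τ, 0 ≤ τ → P τ / 2 = deriv S τ ∧ P' τ / 2 = deriv (deriv S) τ := by
    intro τ hτ
    refine ⟨(hd τ (hδ' τ hτ)).1.deriv.symm, ?_⟩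
    have hev : deriv S =ᶠ[nhds τ] fun s => P s / 2 := by
      filter_upwards [isOpen_Ioi.mem_nhds (hδ' τ hτ)] with s hs using (hd s hs).1.deriv
    rw [hev.deriv_eq, ((hd τ (hδ' τ hτ)).2.div_const 2).deriv]
  have hb : ∀ τ, P τ * (1 - τ * P τ / 2) = 2 * (P τ / 2) * (1 - τ * (P τ / 2)) := fun τ => by ring
  -- The p-equation of the system says exactly that the radial eigenvalue is b(1 − nη/k).
  have ha : ∀ τ, 0 ≤ τ → P τ * (1 - τ * P τ / 2) + 4 * τ * ((P τ / 2) ^ 2 + P' τ / 2)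
      = P τ * (1 - τ * P τ / 2) * (1 - n * (η τ / k)) := by
    intro τ hτ
    obtain ⟨-, -, -, -, -, h1, -⟩ := hprof τ hτ
    have h2 : (n : ℝ) / k * η τ = n * (η τ / k) := by ring
    rw [h2] at h1
    linear_combination h1
  have hQ : ∀ τ, 0 ≤ τ → 0 < P τ * (1 - τ * P τ / 2) := fun τ hτ => by
    obtain ⟨h1, h2, -⟩ := hprof τ hτ
    exact mul_pos h1 (by linarith)
  refine ⟨u, huc, ⟨huc2, hupos, fun x y hxy => by simp only [hu, hxy], fun x => ?_,
    fun j hj hjk x => ?_⟩, ?_, ?_⟩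
  · have hτ : (0 : ℝ) ≤ ‖x‖ ^ 2 := sq_nonneg _
    obtain ⟨hd1, hd2⟩ := hderiv _ hτ
    rw [ellipticEq_iff hk hn (hS2 x) (huS x) rfl hd1 hd2 (hb _), ha _ hτ]
    obtain ⟨-, -, -, -, hF, -, hrel⟩ := hprof _ hτ
    have h1 : radialSigma n (k - 1) (P (‖x‖ ^ 2) * (1 - ‖x‖ ^ 2 * P (‖x‖ ^ 2) / 2)
          * (1 - n * (η (‖x‖ ^ 2) / k))) (P (‖x‖ ^ 2) * (1 - ‖x‖ ^ 2 * P (‖x‖ ^ 2) / 2))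
        = (n.choose k : ℝ) * (P (‖x‖ ^ 2) * (1 - ‖x‖ ^ 2 * P (‖x‖ ^ 2) / 2)) ^ k
          * (1 - η (‖x‖ ^ 2)) := by
      have h2 := mul_radialSigma_profile hkn hk (P (‖x‖ ^ 2) * (1 - ‖x‖ ^ 2 * P (‖x‖ ^ 2) / 2))
        (η (‖x‖ ^ 2) / k)
      rw [mul_comm _ (n : ℝ), mul_choose_pred hk hkn, mul_div_cancel₀ _ hk'.ne'] at h2
      refine mul_left_cancel₀ hk'.ne' (h2.trans ?_)
      ring
    have hexp := Real.exp_pos (S (‖x‖ ^ 2))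
    have h3 : Real.exp (S (‖x‖ ^ 2)) ^ k * ((n.choose k : ℝ)
          * (P (‖x‖ ^ 2) * (1 - ‖x‖ ^ 2 * P (‖x‖ ^ 2) / 2)) ^ k * (1 - η (‖x‖ ^ 2)))
        = ((Real.exp (S (‖x‖ ^ 2)))⁻¹
          * (2 * θ + ρ - 2 * θ * (‖x‖ ^ 2 * P (‖x‖ ^ 2)))) ^ k := by
      rw [mul_pow (Real.exp (S (‖x‖ ^ 2)))⁻¹, ← hrel, inv_pow]
      have := (pow_pos hexp k).ne'
      field_simp
    rw [h1, h3, one_div, Real.pow_rpow_inv_natCast (by positivity) hk.ne']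
    ring
  · have hτ : (0 : ℝ) ≤ ‖x‖ ^ 2 := sq_nonneg _
    obtain ⟨hd1, hd2⟩ := hderiv _ hτ
    obtain ⟨i, rfl⟩ : ∃ i, j = i + 1 := ⟨j - 1, by omega⟩
    rw [sigmaMetric_eq_radialSigma hn hk hupos huc2 (hS2 x) (huS x) i rfl hd1 hd2 (hb _), ha _ hτ]
    refine mul_pos (by positivity) ?_
    have h1 := mul_radialSigma_profile (n := n) (i := i + 1) (by omega) (by omega)
      (P (‖x‖ ^ 2) * (1 - ‖x‖ ^ 2 * P (‖x‖ ^ 2) / 2)) (η (‖x‖ ^ 2) / k)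
    obtain ⟨-, -, hη0, hη1, -⟩ := hprof _ hτ
    have hi : (0 : ℝ) < ((i + 1 : ℕ) : ℝ) := by positivity
    have hik : ((i + 1 : ℕ) : ℝ) ≤ k := by exact_mod_cast hjk
    -- For j ≤ k the factor 1 − jη/k is at least 1 − η > 0, so every σ_j up to order k is positive.
    have h2 : 0 < 1 - ((i + 1 : ℕ) : ℝ) * (η (‖x‖ ^ 2) / k) := by
      have : ((i + 1 : ℕ) : ℝ) * (η (‖x‖ ^ 2) / k) ≤ k * (η (‖x‖ ^ 2) / k) := by gcongr
      rw [mul_div_cancel₀ _ hk'.ne'] at this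
      linarith
    have hch : (0 : ℝ) < ((n - 1).choose (i + 1 - 1) : ℝ) := by
      exact_mod_cast Nat.choose_pos (by omega)
    refine (pos_iff_pos_of_mul_pos ?_).1 hi
    rw [Nat.add_sub_cancel] at h1 hch
    rw [h1]
    exact mul_pos (mul_pos (mul_pos hch hn') (pow_pos (hQ _ hτ) _)) h2
  · simp only [hu, norm_zero]
    rw [zero_pow two_ne_zero, hS0]
    rw [show -A * -(Real.log α / A) = Real.log α by field_simp, Real.exp_log hα]
  · obtain ⟨C, hC⟩ := exists_log_profile_lower_bound hk hnk (fun τ hτ => (hd τ (hδ' τ hτ.le)).1)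
      (fun τ hτ => (hd τ (hδ' τ hτ.le)).2) (η := η) (fun τ hτ => by
        obtain ⟨h1, h2, -, h3, -, h4, -⟩ := hprof τ hτ.le
        exact ⟨h1, h2, h3, h4⟩)
    refine Asymptotics.IsBigO.of_bound (Real.exp (A * C)) ?_
    filter_upwards [(tendsto_norm_cocompact_atTop (E := E n)).eventually_ge_atTop 1] with x hx
    have hxpos : 0 < ‖x‖ := one_pos.trans_le hx
    have h1 := hC (‖x‖ ^ 2) (one_le_pow₀ hx)
    rw [Real.norm_of_nonneg (hupos x).le, Real.norm_of_nonneg (by positivity),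
      Real.rpow_def_of_pos hxpos, ← Real.exp_add]
    refine Real.exp_le_exp.2 ?_
    rw [Real.log_pow] at h1
    have h2 : Real.log ‖x‖ * -(((n : ℝ) + 2 * k) / k) = -A * (2 * Real.log ‖x‖) := by
      rw [hA]; field_simp
    rw [h2]
    push_cast at h1
    nlinarith

end KYamabe

theorem theorem1p4 (n k : ℕ) (hn : 3 ≤ n) (hkn : k ≤ n) (hnk : n < 2 * k) (θ ρ : ℝ) :
    (ρ < 2 * θ → ¬ ∃ u : KYamabe.E n → ℝ, KYamabe.IsAdmissibleRadialSolution k θ ρ u) ∧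
    (ρ ≤ 0 → ¬ ∃ u : KYamabe.E n → ℝ, KYamabe.IsAdmissibleRadialSolution k θ ρ u) ∧
    (0 ≤ θ → 0 < 2 * θ + ρ → 2 * θ ≤ ρ → ∀ m : ℝ, m = ((n : ℝ) - 2 * k) / ((n : ℝ) + 2 * k) →
      ∀ α : ℝ, 0 < α → ∃ u : KYamabe.E n → ℝ,
        ContDiff ℝ (⊤ : ℕ∞) u ∧
        KYamabe.IsAdmissibleRadialSolution k θ ρ u ∧
        u 0 = α ∧
        Asymptotics.IsBigO (Filter.cocompact (KYamabe.E n)) u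
          (fun x => ‖x‖ ^ (-(4 / (1 - m))))) := by
  refine ⟨fun h ⟨u, hu⟩ => ?_, fun h ⟨u, hu⟩ => ?_, fun hθ h0 hρ m hm α hα => ?_⟩
  · linarith [(KYamabe.two_theta_le_and_pos hn hkn hnk hu).1]
  · linarith [(KYamabe.two_theta_le_and_pos hn hkn hnk hu).2]
  · obtain ⟨u, h1, h2, h3, h4⟩ :=
      KYamabe.exists_admissible_radial_solution hn hkn hnk hθ h0 hρ hα
    have hk : (0 : ℝ) < k := by exact_mod_cast (by omega : 0 < k)
    have hnk' : (0 : ℝ) < (n : ℝ) + 2 * k := by positivity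
    have hexp : 4 / (1 - m) = ((n : ℝ) + 2 * k) / k := by
      have : 1 - m = 4 * k / ((n : ℝ) + 2 * k) := by rw [hm]; field_simp; ring
      rw [this]
      field_simp
    rw [hexp]
    exact ⟨u, h1, h2, h3, h4⟩
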